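/- **Setting.** Write $x=(x^0,x^1)\in\mathbb R^2$, $x\cdot y=x^0y^0-x^1y^1$, $\Box=\partial_0^2-\partial_1^2$, $\mathcal D_{\mathbb R}(\mathbb R^n)$ for the real-valued smooth compactly supported functions on $\mathbb R^n$, and $q_f=\int f(x)\,d^2x$ for $f\in\mathcal D_{\mathbb R}(\mathbb R^2)$. For $m>0$ and $f,g\in\mathcal D_{\mathbb R}(\mathbb R^2)$ put $$w_m(f,g)=\frac1{2\pi}\int_{\mathbb R}\frac{dp^1}{2\omega_m(p^1)}\int\!\!\int f(x)\,e^{-ip\cdot(x-y)}\,g(y)\,d^2x\,d^2y,\qquad p=(\omega_m(p^1),p^1),\quad \omega_m(p^1)=\sqrt{(p^1)^2+m^2},$$ and let $D_0(f,g)=\lim_{m\downarrow0}\big(w_m(f,g)-w_m(g,f)\big)$. Let $\mathcal F$ be the $C^*$-algebra generated by Weyl operators $W(f)$, $f\in\mathcal D_{\mathbb R}(\mathbb R^2)$, depending only on the class of $f$ modulo $\Box\mathcal D_{\mathbb R}(\mathbb R^2)$, with $W(0)=1$, $W(f)W(g)=e^{-D_0(f,g)/2}W(f+g)$ and $W(f)^*=W(-f)$.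 The vacuum state on $\mathcal F$ is the state with $$\langle W(f)\rangle=\lim_{m\downarrow0}e^{-\frac12w_m(f,f)},$$ which is $0$ if $q_f\neq0$. Let $(\pi,\mathcal H,\Omega)$ be its GNS representation, and let $U$ be the unitary representation of the proper orthochronous Poincaré group on $\mathcal H$ with $U(L)\pi(W(f))U(L)^{-1}=\pi(W(f_L))$, where $f_L(x)=f(L^{-1}x)$, and $U(L)\Omega=\Omega$. The triple $(\pi(\mathcal F),U,\Omega)$ is the Haag-Kastler net of the massless scalar free field. Let $h\in\mathcal D_{\mathbb R}(\mathbb R)$ with $h\ge0$, $h(t)=h(-t)$ and $\int h(t)\,dt=1$, and put $h_T(t)=\frac1{s(T)}h\big(\frac{t-T}{s(T)}\big)$ with $s(T)=\ln|T|$. For a bounded operator $F$ on $\mathcal H$ put $F_\pm(h_T)=\int dt\,h_T(t)\,U(t_\pm)FU(t_\pm)^{-1}$ (integral taken on vectors of $\mathcal H$), where $t_\pm=(t,\pm t)$ is viewed as a translation. For bounded $F,G$ let $\Psi_T=F_+(h_T)G_-(h_T)\Omega$ and $\Psi_T^\otimes=F_+(h_T)\Omega\otimes G_-(h_T)\Omega$.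 The scattering amplitude $$S(F,G)=\lim_{T\to\infty}\frac{\langle\Psi_T,\Psi_{-T}\rangle}{\langle\Psi^\otimes_T,\Psi^\otimes_{-T}\rangle}$$ is said to exist if the denominator is non-zero for all sufficiently large $T$, the limit exists, and $|S(F,G)|\le1$. **Theorem.** Such data $(\mathcal F,W,\langle\,\cdot\,\rangle,U)$ exist. For any such data, any $h$ as above, and all $f,g\in\mathcal D_{\mathbb R}(\mathbb R^2)$, the scattering amplitude of $F=\pi(W(f))$ and $G=\pi(W(g))$ exists and $$S(F,G)=e^{-\frac i2q_fq_g}.$$ -/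

import Mathlib

open MeasureTheory Filter Topology TopologicalSpace
open scoped ComplexOrder Distributions TensorProduct LineDeriv

noncomputable section

/-! ### Minkowski plane, test functions, charge -/

/-- Two-dimensional Minkowski space; a point is `x = (x⁰, x¹)`. -/
abbrev Spacetime : Type := ℝ × ℝ

/-- The Minkowski product `x · y = x⁰ y⁰ - x¹ y¹`. -/
def minkowski (x y : Spacetime) : ℝ := x.1 * y.1 - x.2 * y.2

/-- Real-valued smooth compactly supported functions on the Minkowski plane. -/
abbrev TestFn : Type := 𝓓((⊤ : Opens Spacetime), ℝ)

/-- The charge `q_f = ∫ f(x) d²x`. -/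
def charge (f : TestFn) : ℝ := ∫ x : Spacetime, f x

/-- The d'Alembertian `□ = ∂₀² - ∂₁²` on test functions. -/
def dAlembertian (f : TestFn) : TestFn :=
  ∂_{((1, 0) : Spacetime)} (∂_{((1, 0) : Spacetime)} f)
    - ∂_{((0, 1) : Spacetime)} (∂_{((0, 1) : Spacetime)} f)

/-! ### The proper orthochronous Poincaré group in two dimensions -/

/-- The Lorentz boost with rapidity `θ`. These maps make up the proper orthochronous Lorentz
group of the Minkowski plane. -/
def boost (θ : ℝ) (x : Spacetime) : Spacetime :=
  (Real.cosh θ * x.1 + Real.sinh θ * x.2, Real.sinh θ * x.1 + Real.cosh θ * x.2)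

/-- The element `x ↦ boost θ x + a` of the proper orthochronous Poincaré group is recorded by its
translation part `a` and its rapidity `θ`. -/
@[ext]
structure Poincare where
  /-- the translation part -/
  trans : Spacetime
  /-- the rapidity of the Lorentz part -/
  rapidity : ℝ

namespace Poincare

instance : One Poincare := ⟨⟨0, 0⟩⟩
instance : Mul Poincare :=
  ⟨fun L M => ⟨L.trans + boost L.rapidity M.trans, L.rapidity + M.rapidity⟩⟩
instance : Inv Poincare := ⟨fun L => ⟨-boost (-L.rapidity) L.trans, -L.rapidity⟩⟩
instance : SMul Poincare Spacetime := ⟨fun L x => boost L.rapidity x + L.trans⟩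

theorem smul_def (L : Poincare) (x : Spacetime) : L • x = boost L.rapidity x + L.trans := rfl
theorem one_def : (1 : Poincare) = ⟨0, 0⟩ := rfl
theorem mul_def (L M : Poincare) :
    L * M = ⟨L.trans + boost L.rapidity M.trans, L.rapidity + M.rapidity⟩ := rfl
theorem inv_def (L : Poincare) : L⁻¹ = ⟨-boost (-L.rapidity) L.trans, -L.rapidity⟩ := rfl

instance : Group Poincare where
  mul_assoc L M N := by
    ext <;> simp [mul_def, boost, Real.cosh_add, Real.sinh_add] <;> ring
  one_mul L := by ext <;> simp [mul_def, one_def, boost]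
  mul_one L := by ext <;> simp [mul_def, one_def, boost]
  inv_mul_cancel L := by ext <;> simp [mul_def, one_def, inv_def, boost]

instance : MulAction Poincare Spacetime where
  one_smul x := by ext <;> simp [smul_def, one_def, boost]
  mul_smul L M x := by
    ext <;> simp [smul_def, mul_def, boost, Real.cosh_add, Real.sinh_add] <;> ring

theorem contDiff_smul (L : Poincare) {n : WithTop ℕ∞} :
    ContDiff ℝ n (fun x : Spacetime => L • x) := by
  simp only [smul_def, boost]
  fun_prop

/-- The translation by `a`. -/
def translation (a : Spacetime) : Poincare := ⟨a, 0⟩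

end Poincare

/-- The transformed test function `f_L(x) = f(L⁻¹ x)`. -/
def TestFn.transform (L : Poincare) (f : TestFn) : TestFn where
  toFun x := f (L⁻¹ • x)
  contDiff' := f.contDiff.comp (L⁻¹).contDiff_smul
  hasCompactSupport' := f.hasCompactSupport.comp_homeomorph
    { toFun := fun x => L⁻¹ • x
      invFun := fun x => L • x
      left_inv := fun x => smul_inv_smul L x
      right_inv := fun x => inv_smul_smul L x
      continuous_toFun := ((L⁻¹).contDiff_smul (n := 0)).continuous
      continuous_invFun := (L.contDiff_smul (n := 0)).continuous }
  tsupport_subset' := fun _ _ => trivial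

/-! ### Two-point functions, commutator function and vacuum functional -/

/-- The energy `ω_m(p¹) = √((p¹)² + m²)`. -/
def energy (m p : ℝ) : ℝ := Real.sqrt (p ^ 2 + m ^ 2)

/-- The two-point function of mass `m > 0`, smeared with two test functions:
`w_m(f, g) = (2π)⁻¹ ∫ dp¹ / (2 ω_m(p¹)) ∫∫ f(x) e^{-i p · (x - y)} g(y) d²x d²y`,
where `p = (ω_m(p¹), p¹)`. -/
def twoPoint (m : ℝ) (f g : TestFn) : ℂ :=
  (2 * Real.pi : ℂ)⁻¹ * ∫ p : ℝ, ((2 * energy m p : ℝ) : ℂ)⁻¹ *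
    ∫ x : Spacetime, ∫ y : Spacetime,
      (f x : ℂ) * Complex.exp (-Complex.I * (minkowski (energy m p, p) (x - y) : ℂ)) * (g y : ℂ)

/-- The commutator function `D₀(x) = lim_{m → 0} (w_m(x) - w_m(-x))`, smeared with two test
functions; the kernel `w_m(-(x - y))` smeared with `f, g` is `w_m(g, f)`. -/
def commutatorFn (f g : TestFn) : ℂ :=
  limUnder (𝓝[>] (0 : ℝ)) fun m => twoPoint m f g - twoPoint m g f

/-- The vacuum expectation value `⟨W(f)⟩ = lim_{m → 0} exp(-w_m(f, f) / 2)`. -/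
def vacuumValue (f : TestFn) : ℂ :=
  limUnder (𝓝[>] (0 : ℝ)) fun m => Complex.exp (-twoPoint m f f / 2)

/-! ### The Weyl algebra, the vacuum state and the vacuum representation -/

/-- A realization of the `C*`-algebra `A` as the Weyl algebra of the symplectic space
`𝓓 / □𝓓` with the symplectic form given by the commutator function: the Weyl operator `W f`
depends only on the class of `f` modulo `□𝓓`, the Weyl relations hold, and the Weyl operators
generate `A` as a `C*`-algebra. -/
structure WeylAlgebra (A : Type*) [CStarAlgebra A] where
  /-- the Weyl operators -/
  W : TestFn → A
  W_zero : W 0 = 1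
  W_add_dAlembertian : ∀ f k : TestFn, W (f + dAlembertian k) = W f
  W_mul : ∀ f g : TestFn, W f * W g = Complex.exp (-commutatorFn f g / 2) • W (f + g)
  W_star : ∀ f : TestFn, star (W f) = W (-f)
  generates : (StarAlgebra.adjoin ℂ (Set.range W)).topologicalClosure = ⊤

/-- The massless scalar free field in its vacuum representation: the Weyl algebra, the state with
the values `vacuumValue f` on the Weyl operators, and the unitary representation of the Poincaré
group on the GNS space of that state which implements the automorphisms `W(f) ↦ W(f_L)` and leaves
the GNS vector (the class of `1`) invariant. -/
structure MasslessFreeField (A : Type*) [CStarAlgebra A] [PartialOrder A] [StarOrderedRing A]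
    extends WeylAlgebra A where
  /-- the vacuum state -/
  state : A →ₚ[ℂ] ℂ
  state_W : ∀ f : TestFn, state (W f) = vacuumValue f
  /-- the representation of the Poincaré group -/
  U : Poincare →* (state.GNS ≃ₗᵢ[ℂ] state.GNS)
  U_implements : ∀ (L : Poincare) (f : TestFn) (ψ : state.GNS),
    U L (state.gnsStarAlgHom (W f) ψ) = state.gnsStarAlgHom (W (f.transform L)) (U L ψ)
  U_vacuum : ∀ L : Poincare,
    U L (state.toPreGNS 1 : state.GNS) = (state.toPreGNS 1 : state.GNS)

namespace MasslessFreeField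

variable {A : Type*} [CStarAlgebra A] [PartialOrder A] [StarOrderedRing A]

/-- The vacuum vector `Ω`, i.e. the cyclic vector of the GNS representation. -/
def vacuum (N : MasslessFreeField A) : N.state.GNS := (N.state.toPreGNS 1 : N.state.GNS)

/-- The operator `π(W(f))` on the GNS space. -/
def weylOp (N : MasslessFreeField A) (f : TestFn) : N.state.GNS →L[ℂ] N.state.GNS :=
  N.state.gnsStarAlgHom (N.W f)

end MasslessFreeField

/-! ### Scattering amplitudes -/

/-- The admissible averaging functions: real test functions on the line which are nonnegative,
even and of integral one. -/
structure IsAveraging (h : 𝓓((⊤ : Opens ℝ), ℝ)) : Prop where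
  nonneg : ∀ t, 0 ≤ h t
  even : ∀ t, h (-t) = h t
  integral_eq_one : ∫ t, h t = 1

/-- `h_T(t) = s(T)⁻¹ h((t - T) / s(T))` with `s(T) = ln |T|`. -/
def rescaled (h : ℝ → ℝ) (T t : ℝ) : ℝ :=
  (Real.log |T|)⁻¹ * h ((t - T) / Real.log |T|)

/-- The two lightlike directions. -/
inductive Lightlike
  | plus
  | minus

/-- The points `t₊ = (t, t)` and `t₋ = (t, -t)`. -/
def Lightlike.point : Lightlike → ℝ → Spacetime
  | .plus, t => (t, t)
  | .minus, t => (t, -t)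

section Scattering

variable {H : Type*} [NormedAddCommGroup H] [InnerProductSpace ℂ H]

/-- The averaged operator `F_±(h_T) = ∫ h_T(t) F(t_±) dt`, applied to a vector `ψ`, where
`F(x) = U(x) F U(x)⁻¹`. -/
def averaged (U : Poincare →* (H ≃ₗᵢ[ℂ] H)) (h : ℝ → ℝ) (lam : Lightlike) (T : ℝ)
    (F : H →L[ℂ] H) (ψ : H) : H :=
  ∫ t : ℝ, (rescaled h T t : ℂ) •
    U (Poincare.translation (lam.point t)) (F (U (Poincare.translation (lam.point t))⁻¹ ψ))

/-- `Ψ_T = F₊(h_T) G₋(h_T) Ω`. -/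
def scatteringVector (U : Poincare →* (H ≃ₗᵢ[ℂ] H)) (Ω : H) (h : ℝ → ℝ) (F G : H →L[ℂ] H)
    (T : ℝ) : H :=
  averaged U h .plus T F (averaged U h .minus T G Ω)

/-- `Ψ^⊗_T = F₊(h_T) Ω ⊗ G₋(h_T) Ω`. -/
def scatteringTensor (U : Poincare →* (H ≃ₗᵢ[ℂ] H)) (Ω : H) (h : ℝ → ℝ) (F G : H →L[ℂ] H)
    (T : ℝ) : H ⊗[ℂ] H :=
  averaged U h .plus T F Ω ⊗ₜ[ℂ] averaged U h .minus T G Ω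

/-- The scattering amplitude `S(F, G)`, formed with the averaging function `h`, exists and is equal
to `S`: the denominators `⟨Ψ^⊗_T, Ψ^⊗_{-T}⟩` are nonzero for large `T`, the quotients
`⟨Ψ_T, Ψ_{-T}⟩ / ⟨Ψ^⊗_T, Ψ^⊗_{-T}⟩` converge to `S` as `T → ∞`, and `|S| ≤ 1`. -/
structure HasScatteringAmplitude (U : Poincare →* (H ≃ₗᵢ[ℂ] H)) (Ω : H) (h : ℝ → ℝ)
    (F G : H →L[ℂ] H) (S : ℂ) : Prop where
  denominator_ne_zero : ∀ᶠ T in atTop,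
    inner ℂ (scatteringTensor U Ω h F G T) (scatteringTensor U Ω h F G (-T)) ≠ 0
  tendsto : Tendsto
    (fun T : ℝ =>
      inner ℂ (scatteringVector U Ω h F G T) (scatteringVector U Ω h F G (-T)) /
        inner ℂ (scatteringTensor U Ω h F G T) (scatteringTensor U Ω h F G (-T)))
    atTop (𝓝 S)
  norm_le_one : ‖S‖ ≤ 1

end Scattering

end

/-!
The massless scalar field on the Minkowski plane splits into right- and left-moving waves, which
do not interact except for the commutation relations of their charges.

*The massless limits.* With the amplitude `A_f(k) = ∫ f(x) e^{-i k · x} d²x`, the two-point function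
`w_m(f, g)` is the integral of `A_f conj A_g` over the mass shell. The antisymmetric part of this
density vanishes at zero momentum, so `D₀(f, g)` is its integral over the light cone; Dirichlet's
integral turns it into the kernel `-i/4 (sgn(x⁰ - x¹) + sgn(x⁰ + x¹))`
(`commutatorFn_eq_lightconeSign`). If `q_f = A_f(0)` vanishes, `w_m(f, f)` converges too; otherwise it
diverges like `log (1 / m)` and the vacuum functional is zero (`tendsto_vacuumValue`).

*Existence.* By the Weyl relations, `⟨W(f) Ω, W(g) Ω⟩` has to be `exp(D₀(f, g) / 2) ⟨W(g - f)⟩`. This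
kernel is the limit of `exp(-w_m(f, f) / 2) exp(-w_m(g, g) / 2) exp(w_m(f, g))`, which is positive by
the Schur product theorem. Its reproducing kernel Hilbert space carries the Weyl operators, and the
closed `*`-algebra they generate, with the vector state of `Ω`, is the required Weyl algebra in its
vacuum state. The kernel is Poincaré invariant, which gives the unitary representation on the GNS
space (`exists_masslessFreeField`).

*Scattering.* For large `T` the averaging functions `h_{±T}` live near `±∞`, because `log T = o(T)`.
Let `f_s` be the right-moving translates of `f` and `g_t` the left-moving ones of `g`. The
differences `f_{s'} - f_s` and `g_{t'} - g_t` are neutral, and their amplitudes have disjoint supports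
on the light cone, as translations along `t_±` act trivially on waves of one of the two directions.
Hence `⟨W(f_s) W(g_t) Ω, W(f_{s'}) W(g_{t'}) Ω⟩` is the product of the overlaps of the single
excitations and the phase `exp(D₀(g_t, f_{s'}) - D₀(g_t, f_s))`
(`MasslessFreeField.inner_weylOp_coherent`). At late `s, t` and early `s'`, `g_t` is spacelike to `f_s`
and lies in the future of `f_{s'}`, so the phase is exactly `exp(-(i/2) q_f q_g)`
(`exists_commutatorFn_shift_eq`). The quotient is therefore constant for large `T`, provided that the
denominators do not vanish; they do not, since each overlap is a fixed phase times an average of the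
positive numbers `⟨W(f_{t'} - f_t)⟩` (`MasslessFreeField.eventually_overlap_ne_zero`).
-/

/-! ### Amplitudes of test functions -/

/-- The Fourier amplitude `A_f(k) = ∫ f(x) e^{-i k · x} d²x`, taken with the Minkowski product. -/
noncomputable def amplitude (f : TestFn) (k : Spacetime) : ℂ :=
  ∫ x : Spacetime, (f x : ℂ) * Complex.exp (-Complex.I * (minkowski k x : ℂ))

theorem norm_exp_neg_I_mul (r : ℝ) : ‖Complex.exp (-Complex.I * (r : ℂ))‖ = 1 := by
  have := Complex.norm_exp_I_mul_ofReal (-r)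
  rwa [Complex.ofReal_neg, mul_neg, ← neg_mul] at this

theorem norm_exp_neg_I_mul_sub_one_le (r : ℝ) :
    ‖Complex.exp (-Complex.I * (r : ℂ)) - 1‖ ≤ |r| := by
  have := Real.norm_exp_I_mul_ofReal_sub_one_le (x := -r)
  rwa [Complex.ofReal_neg, mul_neg, ← neg_mul, norm_neg, Real.norm_eq_abs] at this

theorem conj_exp_neg_I_mul (r : ℝ) :
    (starRingEnd ℂ) (Complex.exp (-Complex.I * (r : ℂ))) = Complex.exp (Complex.I * (r : ℂ)) := by
  rw [← Complex.exp_conj]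
  simp

namespace TestFn

theorem integrable_ofReal_mul (f : TestFn) {φ : Spacetime → ℂ} (hφ : Continuous φ) :
    Integrable (fun x => (f x : ℂ) * φ x) := by
  refine Continuous.integrable_of_hasCompactSupport
    ((Complex.continuous_ofReal.comp f.continuous).mul hφ) ?_
  exact (f.hasCompactSupport.comp_left (g := ((↑) : ℝ → ℂ)) Complex.ofReal_zero).mul_right

theorem integrable_coe (f : TestFn) : Integrable (fun x => f x) :=
  f.continuous.integrable_of_hasCompactSupport f.hasCompactSupport

theorem integrable_abs (f : TestFn) : Integrable (fun x => |f x|) := f.integrable_coe.norm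

theorem integrable_abs_mul_norm (f : TestFn) : Integrable (fun x => |f x| * ‖x‖) :=
  (f.continuous.abs.mul continuous_norm).integrable_of_hasCompactSupport
    (f.hasCompactSupport.norm.mul_right)

theorem lineDerivOp_apply (f : TestFn) (v x : Spacetime) : (∂_{v} f) x = fderiv ℝ f x v := by
  rw [TestFunction.lineDerivOp_eq_lineDerivCLM ℝ, TestFunction.lineDerivCLM_apply]
  have : DifferentiableAt ℝ f x := (f.contDiff.differentiable (by simp)).differentiableAt
  simp [this.lineDeriv_eq_fderiv]

end TestFn

theorem continuous_minkowski_right (k : Spacetime) : Continuous fun x => minkowski k x := by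
  unfold minkowski; fun_prop

theorem continuous_minkowski_left (x : Spacetime) : Continuous fun k => minkowski k x := by
  unfold minkowski; fun_prop

theorem continuous_planeWave (k : Spacetime) :
    Continuous fun x => Complex.exp (-Complex.I * (minkowski k x : ℂ)) := by
  have := continuous_minkowski_right k
  fun_prop

theorem abs_minkowski_le (k x : Spacetime) : |minkowski k x| ≤ (|k.1| + |k.2|) * ‖x‖ := by
  have h1 : |x.1| ≤ ‖x‖ := norm_fst_le x
  have h2 : |x.2| ≤ ‖x‖ := norm_snd_le x
  calc |minkowski k x| ≤ |k.1 * x.1| + |k.2 * x.2| := abs_sub _ _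
    _ = |k.1| * |x.1| + |k.2| * |x.2| := by rw [abs_mul, abs_mul]
    _ ≤ |k.1| * ‖x‖ + |k.2| * ‖x‖ := by gcongr
    _ = _ := by ring

theorem amplitude_zero (k : Spacetime) : amplitude 0 k = 0 := by
  simp [amplitude]

theorem amplitude_add (f g : TestFn) (k : Spacetime) :
    amplitude (f + g) k = amplitude f k + amplitude g k := by
  rw [amplitude, amplitude, amplitude,
    ← integral_add (f.integrable_ofReal_mul (continuous_planeWave k))
      (g.integrable_ofReal_mul (continuous_planeWave k))]
  congr 1; ext x; simp [add_mul]

theorem amplitude_neg (f : TestFn) (k : Spacetime) : amplitude (-f) k = -amplitude f k := by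
  rw [amplitude, amplitude, ← integral_neg]
  congr 1; ext x; simp

theorem amplitude_sub (f g : TestFn) (k : Spacetime) :
    amplitude (f - g) k = amplitude f k - amplitude g k := by
  rw [sub_eq_add_neg, amplitude_add, amplitude_neg, sub_eq_add_neg]

theorem norm_amplitude_le (f : TestFn) (k : Spacetime) : ‖amplitude f k‖ ≤ ∫ x, |f x| := by
  refine (norm_integral_le_integral_norm _).trans (le_of_eq ?_)
  congr 1; ext x
  rw [norm_mul, norm_exp_neg_I_mul, mul_one, Complex.norm_real, Real.norm_eq_abs]

theorem continuous_amplitude (f : TestFn) : Continuous (amplitude f) := by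
  refine continuous_of_dominated (bound := fun x => |f x|)
    (fun k => (f.integrable_ofReal_mul (continuous_planeWave k)).aestronglyMeasurable)
    (fun k => ae_of_all _ fun x => ?_) f.integrable_abs (ae_of_all _ fun x => ?_)
  · rw [norm_mul, norm_exp_neg_I_mul, mul_one, Complex.norm_real, Real.norm_eq_abs]
  · have := continuous_minkowski_left x
    fun_prop

/-- Infrared behaviour: the amplitude differs from the charge by `O(|k|)`. -/
theorem norm_amplitude_sub_charge_le (f : TestFn) (k : Spacetime) :
    ‖amplitude f k - charge f‖ ≤ (∫ x, |f x| * ‖x‖) * (|k.1| + |k.2|) := by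
  have h1 : (charge f : ℂ) = ∫ x : Spacetime, (f x : ℂ) * 1 := by
    simp only [mul_one]
    exact (integral_ofReal (f := fun x => f x)).symm
  rw [h1, amplitude, ← integral_sub (f.integrable_ofReal_mul (continuous_planeWave k))
    (f.integrable_ofReal_mul continuous_const), ← integral_mul_const]
  refine norm_integral_le_of_norm_le (f.integrable_abs_mul_norm.mul_const _)
    (ae_of_all _ fun x => ?_)
  rw [← mul_sub, norm_mul, Complex.norm_real, Real.norm_eq_abs, mul_assoc]
  gcongr
  refine (norm_exp_neg_I_mul_sub_one_le _).trans ((abs_minkowski_le k x).trans (le_of_eq ?_))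
  ring

theorem amplitude_lineDeriv (f : TestFn) (v k : Spacetime) :
    amplitude (∂_{v} f) k = Complex.I * (minkowski k v : ℂ) * amplitude f k := by
  set e : Spacetime → ℂ := fun x => Complex.exp (-Complex.I * (minkowski k x : ℂ)) with he
  set fc : Spacetime → ℂ := fun x => (f x : ℂ) with hfc
  let M : Spacetime →L[ℝ] ℝ :=
    k.1 • ContinuousLinearMap.fst ℝ ℝ ℝ - k.2 • ContinuousLinearMap.snd ℝ ℝ ℝ
  have hM : ∀ x, M x = minkowski k x := fun x => by simp [M, minkowski]
  have hf' : ∀ x, HasFDerivAt fc (Complex.ofRealCLM.comp (fderiv ℝ f x)) x := fun x =>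
    Complex.ofRealCLM.hasFDerivAt.comp x
      ((f.contDiff.differentiable (by simp)).differentiableAt).hasFDerivAt
  have he' : ∀ x, HasFDerivAt e
      ((e x) • ((-Complex.I) • Complex.ofRealCLM.comp M)) x := fun x => by
    have h0 : HasFDerivAt (fun y => (minkowski k y : ℂ)) (Complex.ofRealCLM.comp M) x := by
      have := (Complex.ofRealCLM.comp M).hasFDerivAt (x := x)
      refine this.congr_of_eventuallyEq (Eventually.of_forall fun y => ?_)
      simp [hM]
    exact (h0.const_mul (-Complex.I)).cexp
  have hfe : ∀ x, fderiv ℝ fc x v = ((∂_{v} f) x : ℂ) := fun x => by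
    rw [(hf' x).fderiv, TestFn.lineDerivOp_apply]; rfl
  have hee : ∀ x, fderiv ℝ e x v = e x * (-Complex.I * (minkowski k v : ℂ)) := fun x => by
    rw [(he' x).fderiv]; simp [hM]
  have hec : Continuous e := continuous_planeWave k
  have key := integral_mul_fderiv_eq_neg_fderiv_mul_of_integrable (μ := (volume : Measure Spacetime))
    (f := fc) (g := e) (v := v) (by
      simp only [hfe]; exact TestFn.integrable_ofReal_mul _ hec) (by
      simp only [hee]; exact f.integrable_ofReal_mul (hec.mul continuous_const))
      (f.integrable_ofReal_mul hec) (fun x _ => (hf' x).differentiableAt)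
      (fun x _ => (he' x).differentiableAt)
  simp only [hfe, hee] at key
  have h2 : amplitude (∂_{v} f) k = ∫ x, ((∂_{v} f) x : ℂ) * e x := rfl
  have h3 : amplitude f k = ∫ x, fc x * e x := rfl
  rw [h2, ← neg_eq_iff_eq_neg.mpr key, h3, ← integral_neg, ← integral_const_mul]
  congr 1; ext x; ring

theorem amplitude_dAlembertian (f : TestFn) (k : Spacetime) :
    amplitude (dAlembertian f) k = -(minkowski k k : ℂ) * amplitude f k := by
  rw [dAlembertian, amplitude_sub, amplitude_lineDeriv, amplitude_lineDeriv, amplitude_lineDeriv,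
    amplitude_lineDeriv]
  simp only [minkowski]
  push_cast
  linear_combination ((k.1 : ℂ) ^ 2 - (k.2 : ℂ) ^ 2) * amplitude f k * Complex.I_sq

/-- Rapid decay in the momentum, uniformly in the energy. -/
theorem exists_norm_amplitude_le (f : TestFn) :
    ∃ C, 0 ≤ C ∧ ∀ k : Spacetime, ‖amplitude f k‖ ≤ C / (1 + k.2 ^ 2) := by
  set g : TestFn := ∂_{((0, 1) : Spacetime)} (∂_{((0, 1) : Spacetime)} f)
  have h0 : ∀ f : TestFn, 0 ≤ ∫ x, |f x| := fun f => integral_nonneg fun x => abs_nonneg _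
  refine ⟨(∫ x, |f x|) + ∫ x, |g x|, add_nonneg (h0 f) (h0 g), fun k => ?_⟩
  have hpos : 0 < 1 + k.2 ^ 2 := by positivity
  rw [le_div_iff₀ hpos, mul_add, mul_one]
  have h1 := norm_amplitude_le g k
  have h2 : ‖amplitude g k‖ = k.2 ^ 2 * ‖amplitude f k‖ := by
    simp only [g, amplitude_lineDeriv, norm_mul, Complex.norm_I, Complex.norm_real, minkowski,
      Real.norm_eq_abs]
    simp only [mul_zero, mul_one, zero_sub, abs_neg, one_mul]
    rw [← mul_assoc, abs_mul_abs_self, sq]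
  linarith [norm_amplitude_le f k]

/-! ### Action of the Poincaré group -/

namespace TestFn

theorem transform_apply (L : Poincare) (f : TestFn) (x : Spacetime) :
    f.transform L x = f (L⁻¹ • x) := rfl

theorem transform_add (L : Poincare) (f g : TestFn) :
    (f + g).transform L = f.transform L + g.transform L := by
  ext x; simp [transform_apply]

theorem transform_sub (L : Poincare) (f g : TestFn) :
    (f - g).transform L = f.transform L - g.transform L := by
  ext x; simp [transform_apply]

theorem transform_one (f : TestFn) : f.transform 1 = f := by
  ext x; simp [transform_apply]

theorem transform_mul (L M : Poincare) (f : TestFn) :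
    f.transform (L * M) = (f.transform M).transform L := by
  ext x; simp [transform_apply, mul_smul]

theorem transform_zero (L : Poincare) : (0 : TestFn).transform L = 0 := by
  ext x; simp [transform_apply]

theorem transform_translation_apply (a : Spacetime) (f : TestFn) (x : Spacetime) :
    f.transform (Poincare.translation a) x = f (x - a) := by
  rw [transform_apply]
  congr 1
  ext <;> simp [Poincare.smul_def, Poincare.inv_def, Poincare.translation, boost] <;> ring

end TestFn

/-- Boosts preserve Lebesgue measure, because their determinant is `cosh² - sinh² = 1`. -/
theorem measurePreserving_boost (θ : ℝ) : MeasurePreserving (boost θ) := by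
  let B : Spacetime →ₗ[ℝ] Spacetime := Matrix.toLin (Module.Basis.finTwoProd ℝ)
    (Module.Basis.finTwoProd ℝ) !![Real.cosh θ, Real.sinh θ; Real.sinh θ, Real.cosh θ]
  have hB : ⇑B = boost θ := by
    ext x <;> simp [B, boost]
  have hdet : LinearMap.det B = 1 := by
    rw [LinearMap.det_toLin, Matrix.det_fin_two_of, ← sq, ← sq, Real.cosh_sq_sub_sinh_sq]
  refine ⟨?_, ?_⟩
  · have : Continuous (boost θ) := by unfold boost; fun_prop
    exact this.measurable
  · have := Measure.map_linearMap_addHaar_eq_smul_addHaar (volume : Measure Spacetime)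
      (f := B) (by rw [hdet]; exact one_ne_zero)
    rw [hB, hdet] at this
    simpa using this

theorem integral_poincare_smul {E : Type*} [NormedAddCommGroup E] [NormedSpace ℝ E]
    (L : Poincare) (F : Spacetime → E) : ∫ x, F (L • x) = ∫ x, F x := by
  have hm : MeasurableEmbedding (boost L.rapidity) := by
    refine Continuous.measurableEmbedding (by unfold boost; fun_prop) fun x y hxy => ?_
    have : (L • x : Spacetime) = L • y := by rw [Poincare.smul_def, Poincare.smul_def, hxy]
    exact smul_left_cancel L this
  simp only [Poincare.smul_def]
  rw [(measurePreserving_boost L.rapidity).integral_comp hm (fun y => F (y + L.trans)),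
    integral_add_right_eq_self]

theorem minkowski_boost_boost (θ : ℝ) (x y : Spacetime) :
    minkowski (boost θ x) (boost θ y) = minkowski x y := by
  simp only [minkowski, boost]
  linear_combination (x.1 * y.1 - x.2 * y.2) * Real.cosh_sq_sub_sinh_sq θ

theorem boost_boost_neg (θ : ℝ) (k : Spacetime) :
    boost θ (boost (-θ) k) = k := by
  have := Real.cosh_sq_sub_sinh_sq θ
  ext <;> simp only [boost, Real.cosh_neg, Real.sinh_neg]
  · linear_combination k.1 * this
  · linear_combination k.2 * this

theorem minkowski_add_right (k x y : Spacetime) :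
    minkowski k (x + y) = minkowski k x + minkowski k y := by
  simp [minkowski]; ring

theorem charge_transform (L : Poincare) (f : TestFn) : charge (f.transform L) = charge f := by
  rw [charge, charge, ← integral_poincare_smul L]
  simp [TestFn.transform_apply]

theorem amplitude_transform (L : Poincare) (f : TestFn) (k : Spacetime) :
    amplitude (f.transform L) k = Complex.exp (-Complex.I * (minkowski k L.trans : ℂ)) *
      amplitude f (boost (-L.rapidity) k) := by
  rw [amplitude, amplitude, ← integral_poincare_smul L, ← integral_const_mul]
  congr 1; ext x
  have h : minkowski k (L • x) = minkowski (boost (-L.rapidity) k) x + minkowski k L.trans := by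
    rw [Poincare.smul_def, minkowski_add_right]
    congr 1
    nth_rw 1 [← boost_boost_neg L.rapidity k]
    rw [minkowski_boost_boost]
  rw [TestFn.transform_apply, inv_smul_smul, h]
  push_cast
  rw [mul_add, Complex.exp_add]
  ring

theorem amplitude_translate (a : Spacetime) (f : TestFn) (k : Spacetime) :
    amplitude (f.transform (Poincare.translation a)) k =
      Complex.exp (-Complex.I * (minkowski k a : ℂ)) * amplitude f k := by
  rw [amplitude_transform]
  simp [Poincare.translation, boost]

theorem twoPoint_eq (m : ℝ) (f g : TestFn) :
    twoPoint m f g = (2 * Real.pi : ℂ)⁻¹ * ∫ p : ℝ, ((2 * energy m p : ℝ) : ℂ)⁻¹ *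
      (amplitude f (energy m p, p) * (starRingEnd ℂ) (amplitude g (energy m p, p))) := by
  rw [twoPoint]
  congr 2; ext p
  congr 1
  rw [amplitude, amplitude, ← integral_conj, ← integral_mul_const]
  congr 1; ext x
  rw [← integral_const_mul]
  congr 1; ext y
  rw [map_mul, conj_exp_neg_I_mul, Complex.conj_ofReal]
  have : minkowski (energy m p, p) (x - y) =
      minkowski (energy m p, p) x - minkowski (energy m p, p) y := by
    simp [minkowski]; ring
  rw [this]
  push_cast
  rw [mul_sub, Complex.exp_sub, div_eq_mul_inv, ← Complex.exp_neg]
  ring_nf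

/-! ### Integrals over the mass shell -/

theorem abs_le_energy (m p : ℝ) : |p| ≤ energy m p :=
  Real.abs_le_sqrt (by nlinarith [sq_nonneg m])

theorem abs_mass_le_energy (m p : ℝ) : |m| ≤ energy m p :=
  Real.abs_le_sqrt (by nlinarith [sq_nonneg p])

theorem energy_nonneg (m p : ℝ) : 0 ≤ energy m p := Real.sqrt_nonneg _

theorem energy_pos {m : ℝ} (hm : 0 < m) (p : ℝ) : 0 < energy m p :=
  Real.sqrt_pos.mpr (by positivity)

theorem energy_zero_left (p : ℝ) : energy 0 p = |p| := by simp [energy, Real.sqrt_sq_eq_abs]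

theorem continuous_energy (m : ℝ) : Continuous (energy m) := by unfold energy; fun_prop

theorem continuous_energy_left (p : ℝ) : Continuous fun m => energy m p := by
  unfold energy; fun_prop

/-- The integral of `Φ` over the upper mass shell with the Lorentz invariant measure
`dp¹ / (2 ω_m(p¹))`. For `m = 0` this is the upper light cone. -/
noncomputable def shellIntegral (m : ℝ) (Φ : Spacetime → ℂ) : ℂ :=
  ∫ p : ℝ, ((2 * energy m p : ℝ) : ℂ)⁻¹ * Φ (energy m p, p)

/-- The spectral density `A_f(k) conj A_g(k)` of the two-point function. -/
noncomputable def spectral (f g : TestFn) (k : Spacetime) : ℂ :=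
  amplitude f k * (starRingEnd ℂ) (amplitude g k)

theorem twoPoint_eq_shellIntegral (m : ℝ) (f g : TestFn) :
    twoPoint m f g = (2 * Real.pi : ℂ)⁻¹ * shellIntegral m (spectral f g) := twoPoint_eq m f g

theorem norm_inv_two_energy_mul (m p : ℝ) (z : ℂ) :
    ‖((2 * energy m p : ℝ) : ℂ)⁻¹ * z‖ = (2 * energy m p)⁻¹ * ‖z‖ := by
  rw [norm_mul, norm_inv, Complex.norm_real, Real.norm_of_nonneg
    (mul_nonneg zero_le_two (energy_nonneg m p))]

/-- Continuous densities on momentum space which decay in the spatial momentum uniformly in the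
energy. -/
structure UltravioletRegular (Φ : Spacetime → ℂ) : Prop where
  continuous : Continuous Φ
  decay : ∃ C, 0 ≤ C ∧ ∀ k : Spacetime, ‖Φ k‖ ≤ C / (1 + k.2 ^ 2)

/-- Densities which moreover vanish to first order at zero momentum, so that the singularity of
`1 / ω_m` at `p¹ = 0` does no harm in the massless limit. -/
structure InfraredRegular (Φ : Spacetime → ℂ) : Prop extends UltravioletRegular Φ where
  vanish : ∃ C, 0 ≤ C ∧ ∀ k : Spacetime, ‖Φ k‖ ≤ C * (|k.1| + |k.2|)

theorem aestronglyMeasurable_shell (m : ℝ) {Φ : Spacetime → ℂ} (hΦ : Continuous Φ) :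
    AEStronglyMeasurable (fun p => ((2 * energy m p : ℝ) : ℂ)⁻¹ * Φ (energy m p, p)) volume := by
  have h1 : Continuous fun p => ((2 * energy m p : ℝ) : ℂ) :=
    Complex.continuous_ofReal.comp ((continuous_energy m).const_mul 2)
  have h2 : Continuous fun p => Φ (energy m p, p) :=
    hΦ.comp ((continuous_energy m).prodMk continuous_id)
  exact (h1.measurable.inv.mul h2.measurable).aestronglyMeasurable

namespace UltravioletRegular

theorem add {Φ Φ' : Spacetime → ℂ} (h : UltravioletRegular Φ) (h' : UltravioletRegular Φ') :
    UltravioletRegular (Φ + Φ') := by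
  obtain ⟨C, hC, hΦ⟩ := h.decay
  obtain ⟨C', hC', hΦ'⟩ := h'.decay
  refine ⟨h.continuous.add h'.continuous, C + C', add_nonneg hC hC', fun k => ?_⟩
  rw [add_div]
  exact (norm_add_le _ _).trans (add_le_add (hΦ k) (hΦ' k))

theorem neg {Φ : Spacetime → ℂ} (h : UltravioletRegular Φ) : UltravioletRegular (-Φ) :=
  ⟨h.continuous.neg, by simpa using h.decay⟩

theorem integrable {Φ : Spacetime → ℂ} (h : UltravioletRegular Φ) {m : ℝ} (hm : 0 < m) :
    Integrable fun p => ((2 * energy m p : ℝ) : ℂ)⁻¹ * Φ (energy m p, p) := by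
  obtain ⟨C, hC, hΦ⟩ := h.decay
  refine (integrable_inv_one_add_sq.const_mul ((2 * m)⁻¹ * C)).mono'
    (aestronglyMeasurable_shell m h.continuous) (ae_of_all _ fun p => ?_)
  rw [norm_inv_two_energy_mul, mul_assoc, ← div_eq_mul_inv]
  have h1 : m ≤ energy m p := (le_abs_self m).trans (abs_mass_le_energy m p)
  gcongr
  exact hΦ _

end UltravioletRegular

namespace InfraredRegular

theorem add {Φ Φ' : Spacetime → ℂ} (h : InfraredRegular Φ) (h' : InfraredRegular Φ') :
    InfraredRegular (Φ + Φ') := by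
  obtain ⟨C, hC, hΦ⟩ := h.vanish
  obtain ⟨C', hC', hΦ'⟩ := h'.vanish
  refine ⟨h.toUltravioletRegular.add h'.toUltravioletRegular, C + C', add_nonneg hC hC',
    fun k => ?_⟩
  rw [add_mul]
  exact (norm_add_le _ _).trans (add_le_add (hΦ k) (hΦ' k))

/-- The integrands over all mass shells have a common integrable bound. -/
theorem exists_bound {Φ : Spacetime → ℂ} (h : InfraredRegular Φ) : ∃ C, ∀ m p : ℝ,
    ‖((2 * energy m p : ℝ) : ℂ)⁻¹ * Φ (energy m p, p)‖ ≤ C * (1 + p ^ 2)⁻¹ := by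
  obtain ⟨C, hC, hΦ⟩ := h.vanish
  obtain ⟨C', hC', hΦ'⟩ := h.decay
  refine ⟨2 * C + C', fun m p => ?_⟩
  rw [norm_inv_two_energy_mul]
  have hp := abs_le_energy m p
  have hpos : 0 < 1 + p ^ 2 := by positivity
  rcases (energy_nonneg m p).eq_or_lt with h0 | h0
  · rw [← h0]; simp only [mul_zero, inv_zero, zero_mul]; positivity
  rcases le_total (energy m p) 1 with h1 | h1
  · calc (2 * energy m p)⁻¹ * ‖Φ (energy m p, p)‖
        ≤ (2 * energy m p)⁻¹ * (C * (energy m p + energy m p)) := by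
          gcongr
          refine (hΦ _).trans ?_
          simp only [abs_of_pos h0]
          gcongr
      _ = C := by field_simp; ring
      _ = (C * (1 + p ^ 2)) * (1 + p ^ 2)⁻¹ := by field_simp
      _ ≤ (2 * C + C') * (1 + p ^ 2)⁻¹ := by
          gcongr
          have : p ^ 2 ≤ 1 := (sq_le_one_iff_abs_le_one p).mpr (hp.trans h1)
          nlinarith
  · calc (2 * energy m p)⁻¹ * ‖Φ (energy m p, p)‖
        ≤ 1 * (C' / (1 + p ^ 2)) := by
          gcongr
          · exact inv_le_one_of_one_le₀ (by linarith)
          · exact hΦ' _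
      _ = C' * (1 + p ^ 2)⁻¹ := by rw [one_mul, div_eq_mul_inv]
      _ ≤ (2 * C + C') * (1 + p ^ 2)⁻¹ := by gcongr; linarith

theorem integrable {Φ : Spacetime → ℂ} (h : InfraredRegular Φ) (m : ℝ) :
    Integrable fun p => ((2 * energy m p : ℝ) : ℂ)⁻¹ * Φ (energy m p, p) := by
  obtain ⟨C, hC⟩ := h.exists_bound
  exact (integrable_inv_one_add_sq.const_mul C).mono'
    (aestronglyMeasurable_shell m h.continuous) (ae_of_all _ fun p => hC m p)

theorem tendsto_shellIntegral {Φ : Spacetime → ℂ} (h : InfraredRegular Φ) :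
    Tendsto (fun m => shellIntegral m Φ) (𝓝[>] 0) (𝓝 (shellIntegral 0 Φ)) := by
  obtain ⟨C, hC⟩ := h.exists_bound
  refine tendsto_integral_filter_of_dominated_convergence (fun p => C * (1 + p ^ 2)⁻¹)
    (Eventually.of_forall fun m => aestronglyMeasurable_shell m h.continuous)
    (Eventually.of_forall fun m => ae_of_all _ fun p => hC m p)
    (integrable_inv_one_add_sq.const_mul C) ?_
  have hne : ∀ᵐ p : ℝ, p ≠ 0 := by simp [ae_iff]
  filter_upwards [hne] with p hp
  have h1 : ContinuousAt (fun m => ((2 * energy m p : ℝ) : ℂ)⁻¹ * Φ (energy m p, p)) 0 := by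
    have hc := continuous_energy_left p
    refine ContinuousAt.mul (ContinuousAt.inv₀ ?_ ?_) ?_
    · exact (Complex.continuous_ofReal.comp (hc.const_mul 2)).continuousAt
    · rw [energy_zero_left]; simpa using hp
    · exact (h.continuous.comp (hc.prodMk continuous_const)).continuousAt
  exact h1.tendsto.mono_left nhdsWithin_le_nhds

theorem shellIntegral_add {Φ Φ' : Spacetime → ℂ} (h : InfraredRegular Φ)
    (h' : InfraredRegular Φ') (m : ℝ) :
    shellIntegral m (Φ + Φ') = shellIntegral m Φ + shellIntegral m Φ' := by
  rw [shellIntegral, shellIntegral, shellIntegral,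
    ← integral_add (h.integrable m) (h'.integrable m)]
  congr 1; ext p; simp only [Pi.add_apply]; ring

end InfraredRegular

theorem UltravioletRegular.shellIntegral_add {Φ Φ' : Spacetime → ℂ} (h : UltravioletRegular Φ)
    (h' : UltravioletRegular Φ') {m : ℝ} (hm : 0 < m) :
    shellIntegral m (Φ + Φ') = shellIntegral m Φ + shellIntegral m Φ' := by
  rw [shellIntegral, shellIntegral, shellIntegral,
    ← integral_add (h.integrable hm) (h'.integrable hm)]
  congr 1; ext p; simp only [Pi.add_apply]; ring

theorem shellIntegral_neg (m : ℝ) (Φ : Spacetime → ℂ) :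
    shellIntegral m (-Φ) = -shellIntegral m Φ := by
  rw [shellIntegral, shellIntegral, ← integral_neg]
  congr 1; ext p; simp

theorem shellIntegral_zero_congr {Φ Φ' : Spacetime → ℂ} (h : ∀ p : ℝ, Φ (|p|, p) = Φ' (|p|, p)) :
    shellIntegral 0 Φ = shellIntegral 0 Φ' := by
  simp only [shellIntegral, energy_zero_left, h]

/-! ### Spectral densities -/

theorem continuous_spectral (f g : TestFn) : Continuous (spectral f g) :=
  (continuous_amplitude f).mul (Complex.continuous_conj.comp (continuous_amplitude g))

theorem ultravioletRegular_spectral (f g : TestFn) : UltravioletRegular (spectral f g) := by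
  obtain ⟨C, hC, h⟩ := exists_norm_amplitude_le f
  refine ⟨continuous_spectral f g, C * ∫ x, |g x|,
    mul_nonneg hC (integral_nonneg fun x => abs_nonneg _), fun k => ?_⟩
  rw [spectral, norm_mul, RCLike.norm_conj, mul_div_right_comm]
  gcongr
  · exact h k
  · exact norm_amplitude_le g k

theorem spectral_swap (f g : TestFn) (k : Spacetime) :
    spectral g f k = (starRingEnd ℂ) (spectral f g k) := by
  simp [spectral, mul_comm]

theorem spectral_add_left (f f' g : TestFn) :
    spectral (f + f') g = spectral f g + spectral f' g := by
  ext k; simp [spectral, amplitude_add, add_mul]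

theorem spectral_add_right (f g g' : TestFn) :
    spectral f (g + g') = spectral f g + spectral f g' := by
  ext k; simp [spectral, amplitude_add, mul_add]

theorem spectral_neg_left (f g : TestFn) : spectral (-f) g = -spectral f g := by
  ext k; simp [spectral, amplitude_neg]

theorem spectral_neg_right (f g : TestFn) : spectral f (-g) = -spectral f g := by
  ext k; simp [spectral, amplitude_neg]

theorem infraredRegular_spectral_of_charge_left {f : TestFn} (hf : charge f = 0) (g : TestFn) :
    InfraredRegular (spectral f g) := by
  have h0 : 0 ≤ ∫ x, |f x| * ‖x‖ := integral_nonneg fun x => by positivity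
  have h1 : 0 ≤ ∫ x, |g x| := integral_nonneg fun x => abs_nonneg _
  refine ⟨ultravioletRegular_spectral f g, (∫ x, |f x| * ‖x‖) * ∫ x, |g x|, mul_nonneg h0 h1,
    fun k => ?_⟩
  have h2 := norm_amplitude_sub_charge_le f k
  rw [hf, Complex.ofReal_zero, sub_zero] at h2
  rw [spectral, norm_mul, RCLike.norm_conj, mul_right_comm]
  gcongr
  exact norm_amplitude_le g k

/-- The spectral density of the commutator is infrared regular for all charges: at zero momentum
the two terms both take the value `q_f q_g`. -/
theorem infraredRegular_spectral_sub (f g : TestFn) :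
    InfraredRegular (spectral f g - spectral g f) := by
  have key : ∀ f g : TestFn, ∃ C, 0 ≤ C ∧ ∀ k : Spacetime,
      ‖spectral f g k - charge f * charge g‖ ≤ C * (|k.1| + |k.2|) := fun f g => by
    set a := ∫ x, |f x| * ‖x‖
    set b := ∫ x, |g x| * ‖x‖
    set c := ∫ x, |g x|
    have ha : 0 ≤ a := integral_nonneg fun x => by positivity
    have hb : 0 ≤ b := integral_nonneg fun x => by positivity
    have hc : 0 ≤ c := integral_nonneg fun x => abs_nonneg _
    refine ⟨a * c + |charge f| * b, by positivity, fun k => ?_⟩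
    have e : spectral f g k - charge f * charge g =
        (amplitude f k - charge f) * (starRingEnd ℂ) (amplitude g k) +
          charge f * (starRingEnd ℂ) (amplitude g k - charge g) := by
      simp [spectral]; ring
    rw [e]
    refine (norm_add_le _ _).trans ?_
    rw [norm_mul, norm_mul, RCLike.norm_conj, RCLike.norm_conj, Complex.norm_real,
      Real.norm_eq_abs]
    calc _ ≤ (a * (|k.1| + |k.2|)) * c + |charge f| * (b * (|k.1| + |k.2|)) := by
          gcongr
          · exact norm_amplitude_sub_charge_le f k
          · exact norm_amplitude_le g k
          · exact norm_amplitude_sub_charge_le g k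
      _ = _ := by ring
  obtain ⟨C, hC, h⟩ := key f g
  obtain ⟨C', hC', h'⟩ := key g f
  refine ⟨?_, C + C', add_nonneg hC hC', fun k => ?_⟩
  · rw [sub_eq_add_neg]
    exact (ultravioletRegular_spectral f g).add (ultravioletRegular_spectral g f).neg
  · have e : (spectral f g - spectral g f) k = (spectral f g k - charge f * charge g) -
        (spectral g f k - charge g * charge f) := by
      simp only [Pi.sub_apply]; ring
    rw [e, add_mul]
    exact (norm_sub_le _ _).trans (add_le_add (h k) (h' k))

/-! ### The two-point functions -/

theorem twoPoint_swap (m : ℝ) (f g : TestFn) :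
    twoPoint m g f = (starRingEnd ℂ) (twoPoint m f g) := by
  simp only [twoPoint_eq_shellIntegral, map_mul, shellIntegral, ← integral_conj]
  congr 2
  · rw [map_inv₀, map_mul, Complex.conj_ofReal, Complex.conj_ofNat]
  · ext p
    rw [spectral_swap f g, map_inv₀, Complex.conj_ofReal]

theorem twoPoint_add_left {m : ℝ} (hm : 0 < m) (f f' g : TestFn) :
    twoPoint m (f + f') g = twoPoint m f g + twoPoint m f' g := by
  simp only [twoPoint_eq_shellIntegral, spectral_add_left]
  rw [(ultravioletRegular_spectral f g).shellIntegral_add (ultravioletRegular_spectral f' g) hm,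
    mul_add]

theorem twoPoint_add_right {m : ℝ} (hm : 0 < m) (f g g' : TestFn) :
    twoPoint m f (g + g') = twoPoint m f g + twoPoint m f g' := by
  simp only [twoPoint_eq_shellIntegral, spectral_add_right]
  rw [(ultravioletRegular_spectral f g).shellIntegral_add (ultravioletRegular_spectral f g') hm,
    mul_add]

theorem twoPoint_neg_left (m : ℝ) (f g : TestFn) : twoPoint m (-f) g = -twoPoint m f g := by
  simp only [twoPoint_eq_shellIntegral, spectral_neg_left, shellIntegral_neg, mul_neg]

theorem twoPoint_neg_right (m : ℝ) (f g : TestFn) : twoPoint m f (-g) = -twoPoint m f g := by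
  simp only [twoPoint_eq_shellIntegral, spectral_neg_right, shellIntegral_neg, mul_neg]

theorem twoPoint_self (m : ℝ) (f : TestFn) : twoPoint m f f =
    (((2 * Real.pi)⁻¹ * ∫ p : ℝ, (2 * energy m p)⁻¹ * ‖amplitude f (energy m p, p)‖ ^ 2 : ℝ) :
      ℂ) := by
  rw [twoPoint_eq_shellIntegral, shellIntegral, Complex.ofReal_mul, ← integral_complex_ofReal]
  congr 1
  · push_cast; rfl
  · congr 1; ext p
    rw [spectral, Complex.mul_conj, Complex.normSq_eq_norm_sq]
    push_cast; rfl

theorem twoPoint_self_eq_re (m : ℝ) (f : TestFn) : twoPoint m f f = ((twoPoint m f f).re : ℂ) := by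
  rw [twoPoint_self, Complex.ofReal_re]

theorem twoPoint_self_re_nonneg (m : ℝ) (f : TestFn) : 0 ≤ (twoPoint m f f).re := by
  rw [twoPoint_self, Complex.ofReal_re]
  refine mul_nonneg (by positivity) (integral_nonneg fun p => ?_)
  have := energy_nonneg m p
  positivity

theorem tendsto_twoPoint_of_infraredRegular {f g : TestFn} (h : InfraredRegular (spectral f g)) :
    Tendsto (fun m => twoPoint m f g) (𝓝[>] 0) (𝓝 (twoPoint 0 f g)) := by
  simp only [twoPoint_eq_shellIntegral]
  exact h.tendsto_shellIntegral.const_mul _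

/-- In the parametrization `p¹ = m sinh θ` by the rapidity the invariant measure on the mass shell
is `dθ / 2`. -/
theorem shellIntegral_eq_integral_rapidity {m : ℝ} (hm : 0 < m) (Φ : Spacetime → ℂ) :
    shellIntegral m Φ =
      ∫ θ : ℝ, (2 : ℂ)⁻¹ * Φ (m * Real.cosh θ, m * Real.sinh θ) := by
  have hE : ∀ θ, energy m (m * Real.sinh θ) = m * Real.cosh θ := fun θ => by
    rw [energy, Real.sqrt_eq_iff_eq_sq (by positivity) (by have := Real.cosh_pos θ; positivity)]
    linear_combination -(m ^ 2 * Real.cosh_sq_sub_sinh_sq θ)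
  have hd : ∀ θ ∈ Set.univ, HasDerivWithinAt (fun θ => m * Real.sinh θ) (m * Real.cosh θ)
      Set.univ θ := fun θ _ => ((Real.hasDerivAt_sinh θ).const_mul m).hasDerivWithinAt
  have hinj : Set.InjOn (fun θ => m * Real.sinh θ) Set.univ := fun a _ b _ hab =>
    Real.sinh_injective (mul_left_cancel₀ hm.ne' hab)
  have hsurj : (fun θ => m * Real.sinh θ) '' Set.univ = Set.univ := by
    rw [Set.image_univ, Set.range_eq_univ]
    intro y
    obtain ⟨θ, hθ⟩ := Real.sinh_surjective (y / m)
    exact ⟨θ, by simp only [hθ]; field_simp⟩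
  have := integral_image_eq_integral_abs_deriv_smul MeasurableSet.univ hd hinj
    (fun p : ℝ => ((2 * energy m p : ℝ) : ℂ)⁻¹ * Φ (energy m p, p))
  rw [hsurj, setIntegral_univ, setIntegral_univ] at this
  rw [shellIntegral, this]
  congr 1; ext θ
  have hc := Real.cosh_pos θ
  have hne : ((m * Real.cosh θ : ℝ) : ℂ) ≠ 0 := by exact_mod_cast (mul_pos hm hc).ne'
  rw [hE, abs_of_pos (mul_pos hm hc), Complex.real_smul, ← mul_assoc]
  congr 1
  rw [Complex.ofReal_mul 2, mul_inv, Complex.ofReal_ofNat, mul_left_comm, mul_inv_cancel₀ hne,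
    mul_one]

theorem twoPoint_transform {m : ℝ} (hm : 0 < m) (L : Poincare) (f g : TestFn) :
    twoPoint m (f.transform L) (g.transform L) = twoPoint m f g := by
  simp only [twoPoint_eq_shellIntegral, shellIntegral_eq_integral_rapidity hm]
  rw [← integral_sub_right_eq_self (fun θ => (2 : ℂ)⁻¹ * spectral f g
    (m * Real.cosh θ, m * Real.sinh θ)) L.rapidity]
  congr 2; ext θ
  congr 1
  have hb : boost (-L.rapidity) (m * Real.cosh θ, m * Real.sinh θ) =
      (m * Real.cosh (θ - L.rapidity), m * Real.sinh (θ - L.rapidity)) := by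
    ext <;> simp only [boost, Real.cosh_neg, Real.sinh_neg, Real.cosh_sub, Real.sinh_sub] <;> ring
  rw [spectral, spectral, amplitude_transform, amplitude_transform, hb, map_mul,
    conj_exp_neg_I_mul]
  set r : ℝ := minkowski (m * Real.cosh θ, m * Real.sinh θ) L.trans
  have : Complex.exp (-Complex.I * r) * Complex.exp (Complex.I * r) = 1 := by
    rw [← Complex.exp_add]; simp
  linear_combination (amplitude f (m * Real.cosh (θ - L.rapidity), m * Real.sinh (θ - L.rapidity))
    * (starRingEnd ℂ) (amplitude g (m * Real.cosh (θ - L.rapidity),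
      m * Real.sinh (θ - L.rapidity)))) * this

/-! ### The commutator function -/

theorem twoPoint_sub_twoPoint {m : ℝ} (hm : 0 < m) (f g : TestFn) :
    twoPoint m f g - twoPoint m g f =
      (2 * Real.pi : ℂ)⁻¹ * shellIntegral m (spectral f g - spectral g f) := by
  rw [sub_eq_add_neg (spectral f g), (ultravioletRegular_spectral f g).shellIntegral_add
    (ultravioletRegular_spectral g f).neg hm, shellIntegral_neg, twoPoint_eq_shellIntegral,
    twoPoint_eq_shellIntegral]
  ring

theorem eventually_pos_nhdsGT : ∀ᶠ m : ℝ in 𝓝[>] 0, 0 < m := self_mem_nhdsWithin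

theorem tendsto_twoPoint_sub (f g : TestFn) :
    Tendsto (fun m => twoPoint m f g - twoPoint m g f) (𝓝[>] 0)
      (𝓝 ((2 * Real.pi : ℂ)⁻¹ * shellIntegral 0 (spectral f g - spectral g f))) := by
  refine ((infraredRegular_spectral_sub f g).tendsto_shellIntegral.const_mul _).congr' ?_
  filter_upwards [eventually_pos_nhdsGT] with m hm
  rw [twoPoint_sub_twoPoint hm]

theorem commutatorFn_eq (f g : TestFn) : commutatorFn f g =
    (2 * Real.pi : ℂ)⁻¹ * shellIntegral 0 (spectral f g - spectral g f) :=
  (tendsto_twoPoint_sub f g).limUnder_eq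

/-- The limit which defines the commutator function exists. -/
theorem tendsto_commutatorFn (f g : TestFn) :
    Tendsto (fun m => twoPoint m f g - twoPoint m g f) (𝓝[>] 0) (𝓝 (commutatorFn f g)) := by
  rw [commutatorFn_eq]; exact tendsto_twoPoint_sub f g

theorem commutatorFn_swap (f g : TestFn) : commutatorFn g f = -commutatorFn f g := by
  rw [commutatorFn_eq, commutatorFn_eq, ← neg_sub (spectral f g), shellIntegral_neg, mul_neg]

theorem commutatorFn_self (f : TestFn) : commutatorFn f f = 0 := by
  rw [commutatorFn_eq, sub_self]; simp [shellIntegral]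

theorem commutatorFn_add_left (f f' g : TestFn) :
    commutatorFn (f + f') g = commutatorFn f g + commutatorFn f' g := by
  have : spectral (f + f') g - spectral g (f + f') =
      (spectral f g - spectral g f) + (spectral f' g - spectral g f') := by
    rw [spectral_add_left, spectral_add_right]; abel
  rw [commutatorFn_eq, commutatorFn_eq, commutatorFn_eq, this,
    (infraredRegular_spectral_sub f g).shellIntegral_add (infraredRegular_spectral_sub f' g),
    mul_add]

theorem commutatorFn_neg_left (f g : TestFn) : commutatorFn (-f) g = -commutatorFn f g := by
  have : spectral (-f) g - spectral g (-f) = -(spectral f g - spectral g f) := by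
    rw [spectral_neg_left, spectral_neg_right]; abel
  rw [commutatorFn_eq, commutatorFn_eq, this, shellIntegral_neg, mul_neg]

theorem commutatorFn_add_right (f g g' : TestFn) :
    commutatorFn f (g + g') = commutatorFn f g + commutatorFn f g' := by
  rw [commutatorFn_swap, commutatorFn_add_left, commutatorFn_swap f g, commutatorFn_swap f g']
  ring

theorem commutatorFn_neg_right (f g : TestFn) : commutatorFn f (-g) = -commutatorFn f g := by
  rw [commutatorFn_swap, commutatorFn_neg_left, commutatorFn_swap f g, neg_neg]

theorem commutatorFn_sub_left (f f' g : TestFn) :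
    commutatorFn (f - f') g = commutatorFn f g - commutatorFn f' g := by
  rw [sub_eq_add_neg, commutatorFn_add_left, commutatorFn_neg_left, sub_eq_add_neg]

theorem commutatorFn_sub_right (f g g' : TestFn) :
    commutatorFn f (g - g') = commutatorFn f g - commutatorFn f g' := by
  rw [sub_eq_add_neg, commutatorFn_add_right, commutatorFn_neg_right, sub_eq_add_neg]

theorem conj_commutatorFn (f g : TestFn) :
    (starRingEnd ℂ) (commutatorFn f g) = -commutatorFn f g := by
  have h1 := (Complex.continuous_conj.tendsto _).comp (tendsto_commutatorFn f g)
  refine tendsto_nhds_unique h1 ((tendsto_commutatorFn f g).neg.congr fun m => ?_)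
  simp only [Function.comp_apply, map_sub, ← twoPoint_swap]
  ring

theorem commutatorFn_transform (L : Poincare) (f g : TestFn) :
    commutatorFn (f.transform L) (g.transform L) = commutatorFn f g := by
  refine tendsto_nhds_unique (tendsto_commutatorFn _ _) ((tendsto_commutatorFn f g).congr' ?_)
  filter_upwards [eventually_pos_nhdsGT] with m hm
  rw [twoPoint_transform hm, twoPoint_transform hm]

/-- On the light cone, where `k · k = 0`, the wave operator annihilates amplitudes. -/
theorem amplitude_dAlembertian_lightcone (k : TestFn) (p : ℝ) :
    amplitude (dAlembertian k) (|p|, p) = 0 := by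
  rw [amplitude_dAlembertian]; simp [minkowski]

theorem commutatorFn_dAlembertian_left (k g : TestFn) : commutatorFn (dAlembertian k) g = 0 := by
  have : shellIntegral 0 (spectral (dAlembertian k) g - spectral g (dAlembertian k)) =
      shellIntegral 0 0 := shellIntegral_zero_congr fun p => by
    simp [spectral, amplitude_dAlembertian_lightcone]
  rw [commutatorFn_eq, this]
  simp [shellIntegral]

/-! ### The vacuum functional -/

theorem charge_eq_amplitude (f : TestFn) : (charge f : ℂ) = amplitude f 0 := by
  have := norm_amplitude_sub_charge_le f 0
  simp only [Prod.fst_zero, Prod.snd_zero, abs_zero, add_zero, mul_zero, norm_le_zero_iff,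
    sub_eq_zero] at this
  exact this.symm

theorem charge_sub (f g : TestFn) : charge (f - g) = charge f - charge g := by
  have : (charge (f - g) : ℂ) = charge f - charge g := by
    simp only [charge_eq_amplitude, amplitude_sub]
  exact_mod_cast this

theorem charge_dAlembertian (f : TestFn) : charge (dAlembertian f) = 0 := by
  have : (charge (dAlembertian f) : ℂ) = 0 := by
    rw [charge_eq_amplitude, amplitude_dAlembertian]; simp [minkowski]
  exact_mod_cast this

theorem tendsto_exp_twoPoint_of_charge_eq_zero {f : TestFn} (hf : charge f = 0) :
    Tendsto (fun m => Complex.exp (-twoPoint m f f / 2)) (𝓝[>] 0)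
      (𝓝 (Complex.exp (-twoPoint 0 f f / 2))) :=
  (Complex.continuous_exp.tendsto _).comp ((tendsto_twoPoint_of_infraredRegular
    (infraredRegular_spectral_of_charge_left hf f)).neg.div_const 2)

theorem vacuumValue_of_charge_eq_zero {f : TestFn} (hf : charge f = 0) :
    vacuumValue f = Complex.exp (-twoPoint 0 f f / 2) :=
  (tendsto_exp_twoPoint_of_charge_eq_zero hf).limUnder_eq

/-- For charged `f` the two-point function diverges logarithmically as the mass tends to zero. -/
theorem tendsto_twoPoint_self_of_charge_ne_zero {f : TestFn} (hf : charge f ≠ 0) :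
    Tendsto (fun m => (twoPoint m f f).re) (𝓝[>] 0) atTop := by
  set q := |charge f| with hq
  have hq0 : 0 < q := abs_pos.mpr hf
  have h0 : ‖amplitude f 0‖ = q := by
    rw [← charge_eq_amplitude, Complex.norm_real, Real.norm_eq_abs]
  have hev : ∀ᶠ k in 𝓝 (0 : Spacetime), q / 2 < ‖amplitude f k‖ := by
    refine (continuous_amplitude f).norm.continuousAt.eventually_const_lt ?_
    simp only [h0]; linarith
  obtain ⟨ε, hε, hball⟩ := Metric.eventually_nhds_iff.mp hev
  set δ := ε / 3 with hδ
  have hδ0 : 0 < δ := by positivity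
  have hlog : Tendsto (fun m => (2 * Real.pi)⁻¹ * ((q / 2) ^ 2 / 4 * (Real.log δ - Real.log m)))
      (𝓝[>] 0) atTop := by
    refine Tendsto.const_mul_atTop (by positivity) (Tendsto.const_mul_atTop (by positivity) ?_)
    exact tendsto_atTop_add_const_left _ _ (tendsto_neg_atBot_atTop.comp
      Real.tendsto_log_nhdsGT_zero)
  refine tendsto_atTop_mono' _ ?_ hlog
  have hsmall : ∀ᶠ m : ℝ in 𝓝[>] 0, m < δ :=
    nhdsWithin_le_nhds (gt_mem_nhds hδ0)
  filter_upwards [eventually_pos_nhdsGT, hsmall] with m hm hmδ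
  rw [twoPoint_self, Complex.ofReal_re]
  gcongr
  have hint : Integrable fun p => (2 * energy m p)⁻¹ * ‖amplitude f (energy m p, p)‖ ^ 2 := by
    refine ((ultravioletRegular_spectral f f).integrable hm).norm.congr (ae_of_all _ fun p => ?_)
    simp only [norm_inv_two_energy_mul]
    rw [spectral, norm_mul, RCLike.norm_conj, sq]
  calc (q / 2) ^ 2 / 4 * (Real.log δ - Real.log m)
      = ∫ p in m..δ, (q / 2) ^ 2 / 4 * p⁻¹ := by
        rw [intervalIntegral.integral_const_mul, integral_inv_of_pos hm hδ0,
          Real.log_div hδ0.ne' hm.ne']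
    _ = ∫ p in Set.Ioc m δ, (q / 2) ^ 2 / 4 * p⁻¹ := intervalIntegral.integral_of_le hmδ.le
    _ ≤ ∫ p in Set.Ioc m δ, (2 * energy m p)⁻¹ * ‖amplitude f (energy m p, p)‖ ^ 2 := by
        refine setIntegral_mono_on ?_ hint.integrableOn measurableSet_Ioc fun p hp => ?_
        · refine (ContinuousOn.integrableOn_Icc ?_).mono_set Set.Ioc_subset_Icc_self
          refine continuousOn_const.mul (continuousOn_id.inv₀ fun p hp => ?_)
          exact (hm.trans_le hp.1).ne'
        · have hp0 : 0 < p := hm.trans hp.1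
          have hE0 := energy_pos hm p
          -- on the interval `m ≤ p ≤ δ` the energy is comparable with `p`
          have hE : energy m p ≤ 2 * p := by
            rw [energy, Real.sqrt_le_left (by positivity)]
            nlinarith [hp.1]
          have hA : q / 2 < ‖amplitude f (energy m p, p)‖ := by
            refine hball ?_
            rw [dist_zero_right, Prod.norm_def, max_lt_iff]
            simp only [Real.norm_eq_abs, abs_of_pos hE0, abs_of_pos hp0]
            constructor <;> linarith [hp.2]
          calc (q / 2) ^ 2 / 4 * p⁻¹ = (2 * (2 * p))⁻¹ * (q / 2) ^ 2 := by field_simp; ring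
            _ ≤ _ := by gcongr
    _ ≤ _ := setIntegral_le_integral hint (ae_of_all _ fun p => by
        have := energy_nonneg m p
        positivity)

theorem tendsto_exp_twoPoint_of_charge_ne_zero {f : TestFn} (hf : charge f ≠ 0) :
    Tendsto (fun m => Complex.exp (-twoPoint m f f / 2)) (𝓝[>] 0) (𝓝 0) := by
  rw [tendsto_zero_iff_norm_tendsto_zero]
  have h : Tendsto (fun m => Real.exp (-((twoPoint m f f).re / 2))) (𝓝[>] 0) (𝓝 0) :=
    Real.tendsto_exp_neg_atTop_nhds_zero.comp
      ((tendsto_twoPoint_self_of_charge_ne_zero hf).atTop_div_const two_pos)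
  refine h.congr fun m => ?_
  rw [Complex.norm_exp]
  congr 1
  rw [twoPoint_self_eq_re]
  simp [neg_div]

/-- The limit which defines the vacuum functional exists; it vanishes on charged `f`. -/
theorem tendsto_vacuumValue (f : TestFn) :
    Tendsto (fun m => Complex.exp (-twoPoint m f f / 2)) (𝓝[>] 0) (𝓝 (vacuumValue f)) := by
  by_cases hf : charge f = 0
  · rw [vacuumValue_of_charge_eq_zero hf]
    exact tendsto_exp_twoPoint_of_charge_eq_zero hf
  · have := tendsto_exp_twoPoint_of_charge_ne_zero hf
    rwa [vacuumValue, this.limUnder_eq]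

theorem vacuumValue_transform (L : Poincare) (f : TestFn) :
    vacuumValue (f.transform L) = vacuumValue f := by
  refine tendsto_nhds_unique (tendsto_vacuumValue _) ((tendsto_vacuumValue f).congr' ?_)
  filter_upwards [eventually_pos_nhdsGT] with m hm
  rw [twoPoint_transform hm]

theorem vacuumValue_dAlembertian (k : TestFn) : vacuumValue (dAlembertian k) = 1 := by
  have : shellIntegral 0 (spectral (dAlembertian k) (dAlembertian k)) = shellIntegral 0 0 :=
    shellIntegral_zero_congr fun p => by simp [spectral, amplitude_dAlembertian_lightcone]
  rw [vacuumValue_of_charge_eq_zero (charge_dAlembertian k), twoPoint_eq_shellIntegral, this]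
  simp [shellIntegral]

theorem vacuumValue_neg (f : TestFn) : vacuumValue (-f) = vacuumValue f := by
  simp only [vacuumValue, twoPoint_neg_left, twoPoint_neg_right, neg_neg]

theorem vacuumValue_zero : vacuumValue 0 = 1 := by
  have h : charge 0 = 0 := by simp [charge]
  have h2 : shellIntegral 0 (spectral 0 0) = 0 := by simp [shellIntegral, spectral, amplitude_zero]
  rw [vacuumValue_of_charge_eq_zero h, twoPoint_eq_shellIntegral, h2]
  simp

/-! ### The regularized Dirichlet integral -/

theorem integral_exp_mul_cos_Ioi {ε : ℝ} (hε : 0 < ε) (a : ℝ) :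
    ∫ p in Set.Ioi (0 : ℝ), Real.exp (-ε * p) * Real.cos (a * p) = ε / (ε ^ 2 + a ^ 2) := by
  set c : ℂ := ⟨-ε, a⟩ with hc
  have hre : c.re < 0 := by simp [hc, hε]
  have h1 := integral_exp_mul_complex_Ioi hre 0
  have h2 := integral_re (integrableOn_exp_mul_complex_Ioi hre 0)
  rw [h1] at h2
  have h3 : ∀ p : ℝ, RCLike.re (Complex.exp (c * p)) = Real.exp (-ε * p) * Real.cos (a * p) := by
    intro p
    simp [Complex.exp_re, hc]
  simp only [h3] at h2
  rw [h2]
  simp [Complex.div_re, hc, sq]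

theorem abs_inv_mul_sin_le (a p : ℝ) : |p⁻¹ * Real.sin (a * p)| ≤ |a| := by
  rw [abs_mul, abs_inv]
  have h : |Real.sin (a * p)| ≤ |a| * |p| := by
    rw [← abs_mul]; exact Real.abs_sin_le_abs
  rcases eq_or_ne p 0 with rfl | hp
  · simp
  · rwa [inv_mul_le_iff₀ (abs_pos.mpr hp), mul_comm |p|]

/-- Dirichlet's integral with a convergence factor. -/
theorem integral_exp_mul_sin_div_Ioi {ε : ℝ} (hε : 0 < ε) (a : ℝ) :
    ∫ p in Set.Ioi (0 : ℝ), Real.exp (-ε * p) * (p⁻¹ * Real.sin (a * p)) =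
      Real.arctan (a / ε) := by
  set F : ℝ → ℝ → ℝ := fun a p => Real.exp (-ε * p) * (p⁻¹ * Real.sin (a * p))
  have hexp := exp_neg_integrableOn_Ioi 0 hε
  have hmeas : ∀ a, AEStronglyMeasurable (F a) (volume.restrict (Set.Ioi 0)) := fun a => by
    have : Measurable (F a) := by fun_prop
    exact this.aestronglyMeasurable
  have hderiv : ∀ a, HasDerivAt (fun a => ∫ p in Set.Ioi (0 : ℝ), F a p)
      (ε / (ε ^ 2 + a ^ 2)) a := fun a => by
    rw [← integral_exp_mul_cos_Ioi hε a]
    refine (hasDerivAt_integral_of_dominated_loc_of_deriv_le (s := Set.univ) (F := F)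
      (F' := fun a p => Real.exp (-ε * p) * Real.cos (a * p)) (x₀ := a)
      (bound := fun p => Real.exp (-ε * p)) univ_mem (Eventually.of_forall hmeas) ?_ ?_ ?_
      hexp ?_).2
    · refine (hexp.mul_const |a|).mono' (hmeas a) (ae_of_all _ fun p => ?_)
      rw [Real.norm_eq_abs, abs_mul, Real.abs_exp]
      exact mul_le_mul_of_nonneg_left (abs_inv_mul_sin_le a p) (Real.exp_nonneg _)
    · have : Measurable fun p => Real.exp (-ε * p) * Real.cos (a * p) := by fun_prop
      exact this.aestronglyMeasurable
    · refine ae_of_all _ fun p b _ => ?_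
      rw [Real.norm_eq_abs, abs_mul, Real.abs_exp]
      exact mul_le_of_le_one_right (Real.exp_nonneg _) (Real.abs_cos_le_one _)
    · filter_upwards [ae_restrict_mem measurableSet_Ioi] with p hp b _
      have hp0 : p ≠ 0 := (Set.mem_Ioi.mp hp).ne'
      have h := (((hasDerivAt_id b).mul_const p).sin.const_mul p⁻¹).const_mul (Real.exp (-ε * p))
      refine h.congr_deriv ?_
      simp only [id]
      field_simp
  have harctan : ∀ a, HasDerivAt (fun a => Real.arctan (a / ε)) (ε / (ε ^ 2 + a ^ 2)) a :=
    fun a => by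
      refine ((hasDerivAt_id a).div_const ε).arctan.congr_deriv ?_
      simp only [id]
      field_simp
  have hconst := is_const_of_deriv_eq_zero
    (f := fun a => (∫ p in Set.Ioi (0 : ℝ), F a p) - Real.arctan (a / ε))
    (fun a => ((hderiv a).sub (harctan a)).differentiableAt)
    (fun a => ((hderiv a).sub (harctan a)).deriv.trans (sub_self _)) a 0
  simp only [F, zero_mul, Real.sin_zero, mul_zero, integral_zero, zero_div, Real.arctan_zero,
    sub_zero] at hconst
  linarith

theorem tendsto_arctan_div (a : ℝ) :
    Tendsto (fun ε => Real.arctan (a / ε)) (𝓝[>] 0) (𝓝 (Real.pi / 2 * Real.sign a)) := by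
  have hpos : ∀ a : ℝ, 0 < a → Tendsto (fun ε => Real.arctan (a / ε)) (𝓝[>] 0)
      (𝓝 (Real.pi / 2)) := fun a ha =>
    ((Real.tendsto_arctan_atTop.mono_right nhdsWithin_le_nhds).comp
      (tendsto_inv_nhdsGT_zero.const_mul_atTop ha)).congr fun ε => by
        simp [div_eq_mul_inv]
  rcases lt_trichotomy a 0 with ha | rfl | ha
  · rw [Real.sign_of_neg ha, mul_neg_one]
    refine (hpos (-a) (neg_pos.mpr ha)).neg.congr fun ε => ?_
    rw [neg_div, Real.arctan_neg, neg_neg]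
  · simp
  · rw [Real.sign_of_pos ha, mul_one]
    exact hpos a ha

theorem integrable_exp_neg_mul_abs {ε : ℝ} (hε : 0 < ε) :
    Integrable fun p : ℝ => Real.exp (-ε * |p|) := by
  by_contra h
  have h1 := integral_comp_abs (f := fun p => Real.exp (-ε * p))
  rw [integral_undef h, integral_exp_mul_Ioi (by linarith : -ε < 0)] at h1
  simp at h1
  exact hε.ne' h1

/-! ### The commutator function in position space -/

/-- `sgn(x⁰ - x¹) + sgn(x⁰ + x¹)`, which is `±2` in the future and the past light cone and vanishes
at spacelike points. -/
noncomputable def lightconeSign (x : Spacetime) : ℝ := Real.sign (x.1 - x.2) + Real.sign (x.1 + x.2)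

theorem abs_sign_le_one (r : ℝ) : |Real.sign r| ≤ 1 := by
  rcases Real.sign_apply_eq r with h | h | h <;> simp [h]

theorem abs_lightconeSign_le (x : Spacetime) : |lightconeSign x| ≤ 2 :=
  (abs_add_le _ _).trans (by linarith [abs_sign_le_one (x.1 - x.2), abs_sign_le_one (x.1 + x.2)])

namespace TestFn

theorem integrable_mul_prod (f g : TestFn) :
    Integrable fun z : Spacetime × Spacetime => f z.1 * g z.2 :=
  f.integrable_coe.mul_prod g.integrable_coe

end TestFn

/-- The sine transform of `f ⊗ g`, in terms of which the commutator is expressed. -/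
noncomputable def sineTransform (f g : TestFn) (k : Spacetime) : ℝ :=
  ∫ z : Spacetime × Spacetime, f z.1 * g z.2 * Real.sin (minkowski k (z.1 - z.2))

theorem spectral_sub_swap (f g : TestFn) (k : Spacetime) :
    spectral f g k - spectral g f k = -2 * Complex.I * (sineTransform f g k : ℂ) := by
  set F : Spacetime × Spacetime → ℂ := fun z =>
    ((f z.1 : ℂ) * Complex.exp (-Complex.I * (minkowski k z.1 : ℂ))) *
      ((g z.2 : ℂ) * Complex.exp (Complex.I * (minkowski k z.2 : ℂ))) with hF
  have hgint : Integrable fun y =>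
      (g y : ℂ) * Complex.exp (Complex.I * (minkowski k y : ℂ)) := by
    have := continuous_minkowski_right k
    exact g.integrable_ofReal_mul (by fun_prop)
  have hint : Integrable F :=
    (f.integrable_ofReal_mul (continuous_planeWave k)).mul_prod hgint
  have hS : spectral f g k = ∫ z, F z := by
    have hg : (starRingEnd ℂ) (amplitude g k) =
        ∫ y, (g y : ℂ) * Complex.exp (Complex.I * (minkowski k y : ℂ)) := by
      rw [amplitude, ← integral_conj]
      congr 1; ext y
      rw [map_mul, conj_exp_neg_I_mul, Complex.conj_ofReal]
    rw [spectral, hg, amplitude, ← integral_prod_mul]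
    rfl
  have him : (spectral f g k).im = -sineTransform f g k := by
    have h := integral_im hint
    rw [← hS] at h
    rw [sineTransform, ← integral_neg]
    refine h.symm.trans (integral_congr_ae (ae_of_all _ fun z => ?_))
    have e : F z = ((f z.1 * g z.2 : ℝ) : ℂ) *
        Complex.exp ((-minkowski k (z.1 - z.2) : ℝ) * Complex.I) := by
      have hm : minkowski k (z.1 - z.2) = minkowski k z.1 - minkowski k z.2 := by
        simp [minkowski]; ring
      simp only [hF, hm]
      rw [mul_mul_mul_comm, ← Complex.exp_add]
      push_cast
      congr 2; ring
    simp only [e]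
    change Complex.im _ = _
    rw [Complex.im_ofReal_mul, Complex.exp_ofReal_mul_I_im, Real.sin_neg]
    ring
  rw [spectral_swap f g, Complex.sub_conj, him]
  push_cast; ring

theorem continuous_sineTransform (f g : TestFn) : Continuous (sineTransform f g) := by
  refine continuous_of_dominated (bound := fun z => ‖f z.1 * g z.2‖) (fun k => ?_)
    (fun k => ae_of_all _ fun z => ?_) (f.integrable_mul_prod g).norm
    (ae_of_all _ fun z => ?_)
  · refine (f.integrable_mul_prod g).aestronglyMeasurable.mul ?_
    have : Continuous fun z : Spacetime × Spacetime => Real.sin (minkowski k (z.1 - z.2)) :=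
      Real.continuous_sin.comp ((continuous_minkowski_right k).comp (by fun_prop))
    exact this.aestronglyMeasurable
  · rw [norm_mul]
    exact mul_le_of_le_one_right (norm_nonneg _) (Real.abs_sin_le_one _)
  · exact (Real.continuous_sin.comp (continuous_minkowski_left _)).const_mul _

theorem commutatorFn_eq_sineTransform (f g : TestFn) : commutatorFn f g =
    -(Complex.I / Real.pi) *
      ((∫ p : ℝ, (2 * |p|)⁻¹ * sineTransform f g (|p|, p) : ℝ) : ℂ) := by
  rw [commutatorFn_eq, shellIntegral, ← integral_complex_ofReal, ← integral_const_mul,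
    ← integral_const_mul]
  congr 1; ext p
  rw [energy_zero_left, Pi.sub_apply, spectral_sub_swap, mul_inv]
  push_cast
  ring

theorem integrable_coneWeight {f g : TestFn} {ε : ℝ} (hε : 0 < ε) :
    Integrable (fun w : ℝ × Spacetime × Spacetime => Real.exp (-ε * |w.1|) * ((2 * |w.1|)⁻¹ *
      (f w.2.1 * g w.2.2 * Real.sin (minkowski (|w.1|, w.1) (w.2.1 - w.2.2)))))
      (volume.prod volume) := by
  have hb : Integrable fun z : Spacetime × Spacetime => |f z.1| * |g z.2| * (‖z.1‖ + ‖z.2‖) := by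
    have h1 := f.integrable_abs_mul_norm.mul_prod g.integrable_abs
    have h2 := f.integrable_abs.mul_prod g.integrable_abs_mul_norm
    refine (h1.add h2).congr (ae_of_all _ fun z => ?_)
    simp only [Pi.add_apply]; ring
  refine ((integrable_exp_neg_mul_abs hε).mul_prod hb).mono' ?_ (ae_of_all _ fun w => ?_)
  · have hf : Measurable f := f.continuous.measurable
    have hg : Measurable g := g.continuous.measurable
    have : Measurable fun w : ℝ × Spacetime × Spacetime =>
        Real.exp (-ε * |w.1|) * ((2 * |w.1|)⁻¹ *
      (f w.2.1 * g w.2.2 * Real.sin (minkowski (|w.1|, w.1) (w.2.1 - w.2.2)))) := by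
      unfold minkowski
      fun_prop
    exact this.aestronglyMeasurable
  · rw [Real.norm_eq_abs, abs_mul, Real.abs_exp]
    gcongr
    have hs : |Real.sin (minkowski (|w.1|, w.1) (w.2.1 - w.2.2))| ≤
        (2 * |w.1|) * (‖w.2.1‖ + ‖w.2.2‖) := by
      refine Real.abs_sin_le_abs.trans ((abs_minkowski_le _ _).trans ?_)
      simp only [abs_abs, ← two_mul]
      gcongr
      exact norm_sub_le _ _
    rcases eq_or_ne w.1 0 with h0 | h0
    · simp only [h0, abs_zero, mul_zero, inv_zero, zero_mul]; positivity
    · have hp : 0 < 2 * |w.1| := by positivity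
      rw [abs_mul, abs_mul, abs_mul, abs_inv, abs_of_pos hp, inv_mul_le_iff₀ hp]
      calc |f w.2.1| * |g w.2.2| * |Real.sin (minkowski (|w.1|, w.1) (w.2.1 - w.2.2))|
          ≤ |f w.2.1| * |g w.2.2| * ((2 * |w.1|) * (‖w.2.1‖ + ‖w.2.2‖)) := by gcongr
        _ = _ := by ring

theorem integral_cone_exp_mul_sin {ε : ℝ} (hε : 0 < ε) (x : Spacetime) :
    ∫ p : ℝ, Real.exp (-ε * |p|) * ((2 * |p|)⁻¹ * Real.sin (minkowski (|p|, p) x)) =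
      (Real.arctan ((x.1 - x.2) / ε) + Real.arctan ((x.1 + x.2) / ε)) / 2 := by
  set F : ℝ → ℝ := fun p => Real.exp (-ε * |p|) * ((2 * |p|)⁻¹ * Real.sin (minkowski (|p|, p) x))
  have hmeas : ∀ a : ℝ, Measurable fun p => Real.exp (-ε * p) * (p⁻¹ * Real.sin (a * p)) :=
    fun a => by fun_prop
  have hint : Integrable F := by
    refine ((integrable_exp_neg_mul_abs hε).mul_const ‖x‖).mono' ?_ (ae_of_all _ fun p => ?_)
    · have : Measurable F := by
        unfold F minkowski
        fun_prop
      exact this.aestronglyMeasurable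
    · rw [Real.norm_eq_abs, abs_mul, Real.abs_exp]
      gcongr
      have hs : |Real.sin (minkowski (|p|, p) x)| ≤ (2 * |p|) * ‖x‖ := by
        refine Real.abs_sin_le_abs.trans ((abs_minkowski_le _ _).trans ?_)
        simp only [abs_abs, ← two_mul]
        gcongr
      rcases eq_or_ne p 0 with rfl | h0
      · simp
      · have hp : 0 < 2 * |p| := by positivity
        rwa [abs_mul, abs_inv, abs_of_pos hp, inv_mul_le_iff₀ hp]
  have hIoi : ∀ a : ℝ, IntegrableOn (fun p => Real.exp (-ε * p) * (p⁻¹ * Real.sin (a * p)))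
      (Set.Ioi 0) := fun a => by
    refine ((exp_neg_integrableOn_Ioi 0 hε).mul_const |a|).mono'
      (hmeas a).aestronglyMeasurable (ae_of_all _ fun p => ?_)
    rw [Real.norm_eq_abs, abs_mul, Real.abs_exp]
    exact mul_le_mul_of_nonneg_left (abs_inv_mul_sin_le a p) (Real.exp_nonneg _)
  -- the two half-lines of spatial momenta contribute the two lightlike coordinates
  have hsymm : ∀ p, F p + F (-p) = Real.exp (-ε * |p|) *
      ((2 * |p|)⁻¹ * (Real.sin ((x.1 - x.2) * |p|) + Real.sin ((x.1 + x.2) * |p|))) := fun p => by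
    simp only [F, minkowski, abs_neg]
    rcases le_total 0 p with hp | hp
    · rw [abs_of_nonneg hp]; ring_nf
    · rw [abs_of_nonpos hp]; ring_nf
  have h1 : ∫ p, F p + F (-p) = 2 * ∫ p, F p := by
    rw [integral_add hint hint.comp_neg, integral_neg_eq_self F]; ring
  simp only [hsymm] at h1
  rw [integral_comp_abs (f := fun p => Real.exp (-ε * p) *
      ((2 * p)⁻¹ * (Real.sin ((x.1 - x.2) * p) + Real.sin ((x.1 + x.2) * p))))] at h1
  rw [← mul_left_cancel₀ two_ne_zero h1, ← integral_exp_mul_sin_div_Ioi hε,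
    ← integral_exp_mul_sin_div_Ioi hε, ← integral_add (hIoi _) (hIoi _), ← integral_div]
  congr 1; ext p
  rw [mul_inv]; ring

/-- The massless commutator function is `-i/4 (sgn(x⁰ - x¹) + sgn(x⁰ + x¹))`. A convergence factor
`exp(-ε |p|)` allows the integrations over momenta and positions to be interchanged. -/
theorem commutatorFn_eq_lightconeSign (f g : TestFn) : commutatorFn f g =
    -(Complex.I / 4) * ((∫ z : Spacetime × Spacetime,
      f z.1 * g z.2 * lightconeSign (z.1 - z.2) : ℝ) : ℂ) := by
  have hreg : ∀ ε : ℝ, 0 < ε →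
      ∫ p : ℝ, Real.exp (-ε * |p|) * ((2 * |p|)⁻¹ * sineTransform f g (|p|, p)) =
      ∫ z : Spacetime × Spacetime, f z.1 * g z.2 *
        ((Real.arctan (((z.1 - z.2).1 - (z.1 - z.2).2) / ε) +
          Real.arctan (((z.1 - z.2).1 + (z.1 - z.2).2) / ε)) / 2) := fun ε hε => by
    have h := integral_integral_swap (f := fun (p : ℝ) (z : Spacetime × Spacetime) =>
      Real.exp (-ε * |p|) * ((2 * |p|)⁻¹ * (f z.1 * g z.2 *
        Real.sin (minkowski (|p|, p) (z.1 - z.2))))) (integrable_coneWeight hε)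
    calc _ = _ := by
          simp only [sineTransform, ← integral_const_mul]
      _ = _ := h
      _ = _ := by
          congr 1; ext z
          rw [← integral_cone_exp_mul_sin hε, ← integral_const_mul]
          congr 1; ext p
          ring
  have hleft : Tendsto (fun ε => ∫ p : ℝ, Real.exp (-ε * |p|) *
      ((2 * |p|)⁻¹ * sineTransform f g (|p|, p))) (𝓝[>] 0)
      (𝓝 (∫ p : ℝ, (2 * |p|)⁻¹ * sineTransform f g (|p|, p))) := by
    obtain ⟨C, hC⟩ := (infraredRegular_spectral_sub f g).exists_bound
    refine tendsto_integral_filter_of_dominated_convergence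
      (fun p => C * (1 + p ^ 2)⁻¹) ?_ ?_ (integrable_inv_one_add_sq.const_mul C) ?_
    · refine Eventually.of_forall fun ε => ?_
      have h1 : Continuous fun p : ℝ => sineTransform f g (|p|, p) :=
        (continuous_sineTransform f g).comp (by fun_prop)
      have h2 := h1.measurable
      have : Measurable fun p : ℝ => Real.exp (-ε * |p|) *
        ((2 * |p|)⁻¹ * sineTransform f g (|p|, p)) := by fun_prop
      exact this.aestronglyMeasurable
    · filter_upwards [eventually_pos_nhdsGT] with ε hε
      refine ae_of_all _ fun p => ?_
      have h := hC 0 p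
      rw [norm_inv_two_energy_mul, energy_zero_left, Pi.sub_apply, spectral_sub_swap] at h
      simp only [norm_mul, norm_neg, Complex.norm_ofNat, Complex.norm_I, Complex.norm_real] at h
      rw [norm_mul, norm_mul, Real.norm_of_nonneg (Real.exp_nonneg _),
        Real.norm_of_nonneg (by positivity : 0 ≤ (2 * |p|)⁻¹)]
      have h3 : Real.exp (-ε * |p|) ≤ 1 := by
        rw [Real.exp_le_one_iff]
        nlinarith [abs_nonneg p]
      have h4 : 0 ≤ (2 * |p|)⁻¹ * ‖sineTransform f g (|p|, p)‖ := by positivity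
      calc _ ≤ 1 * ((2 * |p|)⁻¹ * ‖sineTransform f g (|p|, p)‖) := by gcongr
        _ ≤ _ := by linarith
    · refine ae_of_all _ fun p => ?_
      have : Continuous fun ε : ℝ => Real.exp (-ε * |p|) *
        ((2 * |p|)⁻¹ * sineTransform f g (|p|, p)) := by fun_prop
      have h := (this.tendsto 0).mono_left (nhdsWithin_le_nhds (s := Set.Ioi 0))
      simpa using h
  have hright : Tendsto (fun ε => ∫ z : Spacetime × Spacetime, f z.1 * g z.2 *
        ((Real.arctan (((z.1 - z.2).1 - (z.1 - z.2).2) / ε) +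
          Real.arctan (((z.1 - z.2).1 + (z.1 - z.2).2) / ε)) / 2)) (𝓝[>] 0)
      (𝓝 (∫ z : Spacetime × Spacetime, f z.1 * g z.2 *
        (Real.pi / 4 * lightconeSign (z.1 - z.2)))) := by
    have harc : ∀ r : ℝ, |Real.arctan r| ≤ 2 := fun r => by
      rw [abs_le]
      constructor <;> linarith [Real.neg_pi_div_two_lt_arctan r, Real.arctan_lt_pi_div_two r,
        Real.pi_lt_four]
    refine tendsto_integral_filter_of_dominated_convergence
      (fun z => ‖f z.1 * g z.2‖ * 2) ?_ ?_ ((f.integrable_mul_prod g).norm.mul_const 2) ?_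
    · refine Eventually.of_forall fun ε => ?_
      refine (f.integrable_mul_prod g).aestronglyMeasurable.mul ?_
      have : Measurable fun z : Spacetime × Spacetime =>
        ((Real.arctan (((z.1 - z.2).1 - (z.1 - z.2).2) / ε) +
          Real.arctan (((z.1 - z.2).1 + (z.1 - z.2).2) / ε)) / 2) := by fun_prop
      exact this.aestronglyMeasurable
    · refine Eventually.of_forall fun ε => ae_of_all _ fun z => ?_
      rw [norm_mul]
      gcongr
      rw [Real.norm_eq_abs, abs_div, abs_two, div_le_iff₀ two_pos]
      refine (abs_add_le _ _).trans ?_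
      linarith [harc (((z.1 - z.2).1 - (z.1 - z.2).2) / ε),
        harc (((z.1 - z.2).1 + (z.1 - z.2).2) / ε)]
    · refine ae_of_all _ fun z => ?_
      have h := ((tendsto_arctan_div ((z.1 - z.2).1 - (z.1 - z.2).2)).add
        (tendsto_arctan_div ((z.1 - z.2).1 + (z.1 - z.2).2))).div_const 2
      have e : Real.pi / 4 * lightconeSign (z.1 - z.2) =
        (Real.pi / 2 * Real.sign ((z.1 - z.2).1 - (z.1 - z.2).2) +
          Real.pi / 2 * Real.sign ((z.1 - z.2).1 + (z.1 - z.2).2)) / 2 := by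
        rw [lightconeSign]; ring
      rw [e]
      exact h.const_mul _
  have heq := tendsto_nhds_unique (hright.congr' (by
    filter_upwards [eventually_pos_nhdsGT] with ε hε using (hreg ε hε).symm)) hleft
  rw [commutatorFn_eq_sineTransform, ← heq]
  have e2 : ∫ z : Spacetime × Spacetime, f z.1 * g z.2 *
      (Real.pi / 4 * lightconeSign (z.1 - z.2)) = Real.pi / 4 *
      ∫ z : Spacetime × Spacetime, f z.1 * g z.2 * lightconeSign (z.1 - z.2) := by
    rw [← integral_const_mul]
    congr 1; ext z; ring
  rw [e2]
  have hpi : (Real.pi : ℂ) ≠ 0 := by exact_mod_cast Real.pi_ne_zero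
  push_cast
  field_simp

theorem norm_commutatorFn_le (f g : TestFn) :
    ‖commutatorFn f g‖ ≤ 2⁻¹ * ((∫ x, |f x|) * ∫ x, |g x|) := by
  have h : ‖∫ z : Spacetime × Spacetime, f z.1 * g z.2 * lightconeSign (z.1 - z.2)‖ ≤
      2 * ((∫ x, |f x|) * ∫ x, |g x|) := by
    rw [← integral_prod_mul, ← integral_const_mul]
    refine norm_integral_le_of_norm_le ((f.integrable_abs.mul_prod g.integrable_abs).const_mul 2)
      (ae_of_all _ fun z => ?_)
    rw [norm_mul, norm_mul, mul_comm]
    gcongr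
    · exact abs_lightconeSign_le _
    · exact le_rfl
    · exact le_rfl
  rw [commutatorFn_eq_lightconeSign, norm_mul, Complex.norm_real, norm_neg, norm_div,
    Complex.norm_I, Complex.norm_ofNat]
  linarith

/-! ### Positive semidefinite kernels -/

namespace Matrix

variable {X : Type*}

theorem posSemidef_of_tendsto {ι : Type*} {l : Filter ι} [l.NeBot] {M : ι → Matrix X X ℂ}
    {N : Matrix X X ℂ} (hM : ∀ᶠ n in l, (M n).PosSemidef)
    (h : ∀ x y, Tendsto (fun n => M n x y) l (𝓝 (N x y))) : N.PosSemidef := by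
  refine ⟨?_, fun c => ?_⟩
  · ext x y
    rw [Matrix.conjTranspose_apply]
    refine tendsto_nhds_unique ((continuous_star.tendsto _).comp (h y x)) ((h x y).congr' ?_)
    filter_upwards [hM] with n hn using (hn.isHermitian.apply x y).symm
  · refine ge_of_tendsto (x := l) (f := fun n =>
      c.sum fun i ci => c.sum fun j cj => star ci * M n i j * cj) ?_ ?_
    · exact tendsto_finsetSum _ fun i _ => tendsto_finsetSum _ fun j _ =>
        ((h i j).const_mul _).mul_const _
    · filter_upwards [hM] with n hn using hn.2 c

theorem posSemidef_rankOne (d : X → ℂ) :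
    (Matrix.of fun x y => star (d x) * d y).PosSemidef := by
  refine ⟨?_, fun c => ?_⟩
  · ext x y; simp [mul_comm]
  · have : (c.sum fun i ci => c.sum fun j cj => star ci * (star (d i) * d j) * cj) =
        star (c.sum fun j cj => d j * cj) * (c.sum fun j cj => d j * cj) := by
      simp only [Finsupp.sum, star_sum, Finset.sum_mul_sum, star_mul]
      refine Finset.sum_congr rfl fun i _ => Finset.sum_congr rfl fun j _ => by ring
    simp only [Matrix.of_apply, this]
    exact star_mul_self_nonneg _

theorem PosSemidef.map_one_add_div_pow {M : Matrix X X ℂ} (hM : M.PosSemidef) (k n : ℕ) :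
    (Matrix.of fun x y => (1 + M x y / k) ^ n).PosSemidef := by
  have hone : (Matrix.of fun _ _ : X => (1 : ℂ)).PosSemidef := by
    simpa using posSemidef_rankOne (fun _ : X => (1 : ℂ))
  induction n with
  | zero => simpa using hone
  | succ n ih =>
    have h1 : (Matrix.of fun x y => 1 + M x y / k).PosSemidef := by
      have hk : (0 : ℂ) ≤ (k : ℂ)⁻¹ := by
        rw [inv_nonneg]; exact_mod_cast Nat.zero_le k
      convert hone.add (hM.smul hk) using 1
      ext x y
      simp [div_eq_inv_mul]
    have e : (Matrix.of fun x y => (1 + M x y / k) ^ (n + 1)) =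
        Matrix.hadamard (Matrix.of fun x y => (1 + M x y / k) ^ n)
          (Matrix.of fun x y => 1 + M x y / k) := by
      ext x y
      simp [pow_succ, Matrix.hadamard_apply]
    rw [e]
    exact ih.hadamard h1

/-- The entrywise exponential of a positive semidefinite kernel is positive semidefinite: it is the
limit of the kernels `(1 + M / n)ⁿ`, to which the Schur product theorem applies. -/
theorem PosSemidef.map_exp {M : Matrix X X ℂ} (hM : M.PosSemidef) :
    (Matrix.of fun x y => Complex.exp (M x y)).PosSemidef :=
  posSemidef_of_tendsto (Eventually.of_forall fun n => hM.map_one_add_div_pow n n)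
    fun x y => Complex.tendsto_one_add_div_pow_exp (M x y)

end Matrix

/-! ### The kernel of the Weyl operators -/

theorem posSemidef_twoPoint {m : ℝ} (hm : 0 < m) :
    (Matrix.of fun f g : TestFn => twoPoint m f g).PosSemidef := by
  refine ⟨?_, fun c => ?_⟩
  · ext f g
    exact (twoPoint_swap m g f).symm
  have h : (c.sum fun i ci => c.sum fun j cj => star ci * twoPoint m i j * cj) =
      (2 * Real.pi : ℂ)⁻¹ * ∫ p : ℝ, ((2 * energy m p : ℝ) : ℂ)⁻¹ *
        (c.sum fun i ci => c.sum fun j cj => star ci * spectral i j (energy m p, p) * cj) := by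
    simp only [Finsupp.sum, Finset.mul_sum]
    have hint : ∀ i j, Integrable fun p : ℝ => ((2 * energy m p : ℝ) : ℂ)⁻¹ *
        (star (c i) * spectral i j (energy m p, p) * c j) := fun i j =>
      (((ultravioletRegular_spectral i j).integrable hm).const_mul
        (star (c i) * c j)).congr (ae_of_all _ fun p => by ring)
    rw [integral_finsetSum _ fun i _ => integrable_finsetSum _ fun j _ => hint i j,
      Finset.mul_sum]
    refine Finset.sum_congr rfl fun i _ => ?_
    rw [integral_finsetSum _ fun j _ => hint i j, Finset.mul_sum]
    refine Finset.sum_congr rfl fun j _ => ?_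
    rw [twoPoint_eq_shellIntegral, shellIntegral, ← integral_const_mul, ← integral_const_mul,
      ← integral_const_mul, ← integral_mul_const]
    congr 1; ext p; ring
  simp only [Matrix.of_apply]
  rw [h]
  refine mul_nonneg (by rw [inv_nonneg]; exact_mod_cast Real.two_pi_pos.le)
    (integral_nonneg fun p => mul_nonneg ?_ ?_)
  · rw [inv_nonneg]
    exact Complex.zero_le_real.mpr (mul_nonneg zero_le_two (energy_nonneg m p))
  · have := (Matrix.posSemidef_rankOne
      fun f : TestFn => star (amplitude f (energy m p, p))).2 c
    simpa [spectral] using this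

/-- The inner products `⟨W(f) Ω, W(g) Ω⟩` in the vacuum representation. -/
noncomputable def weylKernel (f g : TestFn) : ℂ :=
  Complex.exp (commutatorFn f g / 2) * vacuumValue (g - f)

theorem twoPoint_sub_sub {m : ℝ} (hm : 0 < m) (f g : TestFn) :
    twoPoint m (g - f) (g - f) =
      twoPoint m g g - twoPoint m g f - twoPoint m f g + twoPoint m f f := by
  rw [sub_eq_add_neg, twoPoint_add_left hm, twoPoint_add_right hm, twoPoint_add_right hm]
  simp only [twoPoint_neg_left, twoPoint_neg_right]
  ring

theorem tendsto_weylKernel (f g : TestFn) :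
    Tendsto (fun m => Complex.exp (-twoPoint m f f / 2) * Complex.exp (-twoPoint m g g / 2) *
      Complex.exp (twoPoint m f g)) (𝓝[>] 0) (𝓝 (weylKernel f g)) := by
  have h1 := (Complex.continuous_exp.tendsto _).comp ((tendsto_commutatorFn f g).div_const 2)
  refine (h1.mul (tendsto_vacuumValue (g - f))).congr' ?_
  filter_upwards [eventually_pos_nhdsGT] with m hm
  rw [Function.comp_apply, ← Complex.exp_add, ← Complex.exp_add, ← Complex.exp_add,
    twoPoint_sub_sub hm]
  congr 1; ring

/-- The kernel is a limit of the kernels of positive mass, which are Schur products of a kernel of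
rank one and the exponential of the two-point function. -/
theorem posSemidef_weylKernel : (Matrix.of weylKernel).PosSemidef := by
  refine Matrix.posSemidef_of_tendsto (l := 𝓝[>] (0 : ℝ))
    (M := fun m => Matrix.of fun f g => Complex.exp (-twoPoint m f f / 2) *
      Complex.exp (-twoPoint m g g / 2) * Complex.exp (twoPoint m f g)) ?_ tendsto_weylKernel
  filter_upwards [eventually_pos_nhdsGT] with m hm
  have h1 := Matrix.posSemidef_rankOne fun f : TestFn => Complex.exp (-twoPoint m f f / 2)
  have h2 : ∀ f, star (Complex.exp (-twoPoint m f f / 2)) = Complex.exp (-twoPoint m f f / 2) :=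
    fun f => by
      rw [Complex.star_def, ← Complex.exp_conj, map_div₀, map_neg, ← twoPoint_swap,
        Complex.conj_ofNat]
  have e : (Matrix.of fun f g : TestFn => star (Complex.exp (-twoPoint m f f / 2)) *
      Complex.exp (-twoPoint m g g / 2)) = Matrix.of fun f g : TestFn =>
        Complex.exp (-twoPoint m f f / 2) * Complex.exp (-twoPoint m g g / 2) := by
    ext f g
    rw [Matrix.of_apply, Matrix.of_apply, h2]
  rw [e] at h1
  exact h1.hadamard (posSemidef_twoPoint hm).map_exp

theorem weylKernel_self (f : TestFn) : weylKernel f f = 1 := by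
  simp [weylKernel, commutatorFn_self, vacuumValue_zero]

theorem weylKernel_transform (L : Poincare) (f g : TestFn) :
    weylKernel (f.transform L) (g.transform L) = weylKernel f g := by
  rw [weylKernel, weylKernel, commutatorFn_transform, ← TestFn.transform_sub,
    vacuumValue_transform]

theorem commutatorFn_zero_left (f : TestFn) : commutatorFn 0 f = 0 := by
  rw [← sub_self f, commutatorFn_sub_left, sub_self]

theorem commutatorFn_zero_right (f : TestFn) : commutatorFn f 0 = 0 := by
  rw [commutatorFn_swap, commutatorFn_zero_left, neg_zero]

theorem weylKernel_zero_left (f : TestFn) : weylKernel 0 f = vacuumValue f := by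
  simp [weylKernel, commutatorFn_zero_left]

/-! ### Hilbert spaces with prescribed inner products -/

/-- A positive semidefinite kernel is the Gram matrix of a total family: take the kernel functions
in the reproducing kernel Hilbert space. -/
theorem exists_hilbert_of_posSemidef {X : Type} {k : Matrix X X ℂ} (hk : k.PosSemidef) :
    ∃ (H : Type) (_ : NormedAddCommGroup H) (_ : InnerProductSpace ℂ H) (_ : CompleteSpace H)
      (e : X → H), (∀ x y, inner ℂ (e x) (e y) = k x y) ∧
        Dense (Submodule.span ℂ (Set.range e) : Set H) := by
  let K : Matrix X X (ℂ →L[ℂ] ℂ) := Matrix.of fun x y => k x y • (1 : ℂ →L[ℂ] ℂ)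
  have hK : K.PosSemidef := by
    have tfae := (RKHS.posSemidef_tfae (K := K)).out 0 2
    refine tfae.mpr ⟨?_, fun c => ?_⟩
    · ext x y
      have := hk.isHermitian.apply x y
      simp only [K, Matrix.conjTranspose_apply, Matrix.of_apply, star_smul, this, star_one]
    · have h := (RCLike.nonneg_iff.mp (hk.2 c)).1
      have e : ∀ x w x' w', inner ℂ (K x' x w) w' = star w * k x x' * w' := fun x w x' w' => by
        rw [← hk.isHermitian.apply x x']
        simp [K]
        ring
      simpa only [e] using h
  have : Fact K.PosSemidef := ⟨hK⟩
  refine ⟨RKHS.OfKernel K, inferInstance, inferInstance, inferInstance,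
    fun x => RKHS.kerFun (RKHS.OfKernel K) x 1, fun x y => ?_, ?_⟩
  · rw [← RKHS.kernel_inner, RKHS.OfKernel.kernel_ofKernel]
    have := hk.isHermitian.apply x y
    rw [← this]
    simp [K]
  · rw [Submodule.dense_iff_topologicalClosure_eq_top, eq_top_iff,
      ← RKHS.kerFun_dense (RKHS.OfKernel K)]
    refine Submodule.topologicalClosure_mono (Submodule.span_le.mpr ?_)
    rintro _ ⟨x, v, rfl⟩
    have : RKHS.kerFun (RKHS.OfKernel K) x v = v • RKHS.kerFun (RKHS.OfKernel K) x 1 := by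
      rw [← map_smul, smul_eq_mul, mul_one]
    rw [this]
    exact Submodule.smul_mem _ _ (Submodule.subset_span ⟨x, rfl⟩)

section Gram

variable {X : Type*} {H H' : Type*} [NormedAddCommGroup H] [InnerProductSpace ℂ H]
  [NormedAddCommGroup H'] [InnerProductSpace ℂ H'] [CompleteSpace H']

/-- Total families with the same inner products are related by an isometry. -/
theorem exists_isometry_of_inner_eq {e : X → H} {e' : X → H'}
    (he : Dense (Submodule.span ℂ (Set.range e) : Set H))
    (h : ∀ x y, inner ℂ (e' x) (e' y) = inner ℂ (e x) (e y)) :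
    ∃ T : H →ₗᵢ[ℂ] H', ∀ x, T (e x) = e' x := by
  set E := Finsupp.linearCombination ℂ e
  set E' := Finsupp.linearCombination ℂ e'
  have hinner : ∀ c, inner ℂ (E' c) (E' c) = inner ℂ (E c) (E c) := fun c => by
    simp only [E, E', Finsupp.linearCombination_apply, Finsupp.sum, sum_inner, inner_sum,
      inner_smul_left, inner_smul_right, h]
  have hnorm : ∀ c, ‖E' c‖ = ‖E c‖ := fun c => by
    rw [@norm_eq_sqrt_re_inner ℂ, hinner, ← @norm_eq_sqrt_re_inner ℂ]
  have hd : DenseRange E := by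
    have : Set.range E = (Submodule.span ℂ (Set.range e) : Set H) := by
      rw [← Finsupp.range_linearCombination]; rfl
    rw [DenseRange, this]; exact he
  have hb : ∃ C, ∀ c, ‖E' c‖ ≤ C * ‖E c‖ := ⟨1, fun c => by rw [one_mul, hnorm]⟩
  set T := E'.extendOfNorm E
  have hT : ∀ c, T (E c) = E' c := LinearMap.extendOfNorm_eq hd hb
  refine ⟨⟨T.toLinearMap, fun x => ?_⟩, fun x => ?_⟩
  · refine hd.induction_on (p := fun x => ‖T x‖ = ‖x‖) x
      (isClosed_eq (T.continuous.norm) continuous_norm) fun c => ?_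
    rw [hT, hnorm]
  · have := hT (Finsupp.single x 1)
    simpa [E, E'] using this

theorem exists_unitary_representation [CompleteSpace H] {G : Type*} [Group G] {e : X → H}
    (he : Dense (Submodule.span ℂ (Set.range e) : Set H)) (a : G → X → X)
    (hone : ∀ x, a 1 x = x) (hmul : ∀ g h x, a (g * h) x = a g (a h x))
    (hinner : ∀ g x y, inner ℂ (e (a g x)) (e (a g y)) = inner ℂ (e x) (e y)) :
    ∃ U : G →* (H ≃ₗᵢ[ℂ] H), ∀ g x, U g (e x) = e (a g x) := by
  choose T hT using fun g => exists_isometry_of_inner_eq he (hinner g)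
  have hcomp : ∀ g h ψ, T (g * h) ψ = T g (T h ψ) := fun g h ψ => by
    have : (T (g * h)).toContinuousLinearMap =
        (T g).toContinuousLinearMap ∘L (T h).toContinuousLinearMap := by
      refine ContinuousLinearMap.ext_on he ?_
      rintro _ ⟨x, rfl⟩
      simp [hT, hmul]
    exact congrArg (fun S => S ψ) this
  have hid : ∀ ψ, T 1 ψ = ψ := fun ψ => by
    have : (T 1).toContinuousLinearMap = ContinuousLinearMap.id ℂ H := by
      refine ContinuousLinearMap.ext_on he ?_
      rintro _ ⟨x, rfl⟩
      simp [hT, hone]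
    exact congrArg (fun S => S ψ) this
  let V : G → (H ≃ₗᵢ[ℂ] H) := fun g =>
    { toLinearEquiv := LinearEquiv.ofLinearMap (T g).toLinearMap (T g⁻¹).toLinearMap
        (LinearMap.ext fun ψ => by
          change T g (T g⁻¹ ψ) = ψ
          rw [← hcomp, mul_inv_cancel, hid])
        (LinearMap.ext fun ψ => by
          change T g⁻¹ (T g ψ) = ψ
          rw [← hcomp, inv_mul_cancel, hid])
      norm_map' := (T g).norm_map }
  refine ⟨MonoidHom.mk' V fun g h => LinearIsometryEquiv.ext fun ψ => hcomp g h ψ,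
    fun g x => hT g x⟩

end Gram

/-! ### The vacuum representation of a Weyl algebra -/

namespace WeylAlgebra

variable {A : Type*} [CStarAlgebra A]

theorem star_W_mul_W (N : WeylAlgebra A) (f g : TestFn) :
    star (N.W f) * N.W g = Complex.exp (commutatorFn f g / 2) • N.W (g - f) := by
  rw [N.W_star, N.W_mul, commutatorFn_neg_left, neg_neg, neg_add_eq_sub]

/-- By the Weyl relations the linear span of the Weyl operators is already a `*`-algebra. -/
theorem dense_span_W (N : WeylAlgebra A) :
    Dense (Submodule.span ℂ (Set.range N.W) : Set A) := by
  have hmul : ∀ x ∈ Submodule.span ℂ (Set.range N.W), ∀ y ∈ Submodule.span ℂ (Set.range N.W),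
      x * y ∈ Submodule.span ℂ (Set.range N.W) := fun x hx y hy => by
    induction hx, hy using Submodule.span_induction₂ with
    | mem_mem x y hx hy =>
      obtain ⟨f, rfl⟩ := hx
      obtain ⟨g, rfl⟩ := hy
      rw [N.W_mul]
      exact Submodule.smul_mem _ _ (Submodule.subset_span ⟨_, rfl⟩)
    | zero_left y _ => rw [zero_mul]; exact Submodule.zero_mem _
    | zero_right x _ => rw [mul_zero]; exact Submodule.zero_mem _
    | add_left x y z _ _ _ h1 h2 => rw [add_mul]; exact Submodule.add_mem _ h1 h2
    | add_right x y z _ _ _ h1 h2 => rw [mul_add]; exact Submodule.add_mem _ h1 h2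
    | smul_left r x y _ _ h => rw [smul_mul_assoc]; exact Submodule.smul_mem _ _ h
    | smul_right r x y _ _ h => rw [mul_smul_comm]; exact Submodule.smul_mem _ _ h
  have hle : (StarAlgebra.adjoin ℂ (Set.range N.W) : Set A) ⊆
      Submodule.span ℂ (Set.range N.W) := fun x hx => by
    induction hx using StarAlgebra.adjoin_induction with
    | mem x hx => exact Submodule.subset_span hx
    | algebraMap r =>
      rw [Algebra.algebraMap_eq_smul_one, ← N.W_zero]
      exact Submodule.smul_mem _ _ (Submodule.subset_span ⟨_, rfl⟩)
    | add x y _ _ hx hy => exact Submodule.add_mem _ hx hy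
    | mul x y _ _ hx hy => exact hmul x hx y hy
    | star x hadj hx =>
      clear hadj
      change x ∈ Submodule.span ℂ (Set.range N.W) at hx
      change star x ∈ Submodule.span ℂ (Set.range N.W)
      induction hx using Submodule.span_induction with
      | mem x hx =>
        obtain ⟨f, rfl⟩ := hx
        rw [N.W_star]
        exact Submodule.subset_span ⟨_, rfl⟩
      | zero => rw [star_zero]; exact Submodule.zero_mem _
      | add x y _ _ hx hy => rw [star_add]; exact Submodule.add_mem _ hx hy
      | smul r x _ hx => rw [star_smul]; exact Submodule.smul_mem _ _ hx
  refine Dense.mono hle ?_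
  have h := N.generates
  rw [dense_iff_closure_eq, ← StarSubalgebra.topologicalClosure_coe, h]
  rfl

variable [PartialOrder A] [StarOrderedRing A] (N : WeylAlgebra A) {φ : A →ₚ[ℂ] ℂ}

/-- The vector `π(W(f)) Ω` of the GNS space. -/
noncomputable def coherentVector (φ : A →ₚ[ℂ] ℂ) (f : TestFn) : φ.GNS :=
  (φ.toPreGNS (N.W f) : φ.GNS)

theorem coherentVector_zero : N.coherentVector φ 0 = (φ.toPreGNS 1 : φ.GNS) := by
  rw [coherentVector, N.W_zero]

theorem gnsStarAlgHom_coherentVector (f g : TestFn) :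
    φ.gnsStarAlgHom (N.W f) (N.coherentVector φ g) =
      Complex.exp (-commutatorFn f g / 2) • N.coherentVector φ (f + g) := by
  have h : φ.gnsStarAlgHom (N.W f) (N.coherentVector φ g) =
      (φ.toPreGNS (N.W f * N.W g) : φ.GNS) := by
    change φ.gnsNonUnitalStarAlgHom (N.W f) (φ.toPreGNS (N.W g) : φ.GNS) = _
    rw [PositiveLinearMap.gnsNonUnitalStarAlgHom_apply_coe,
      PositiveLinearMap.leftMulMapPreGNS_apply]
    rfl
  rw [h, N.W_mul, map_smul, UniformSpace.Completion.coe_smul]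
  rfl

theorem inner_coherentVector (hφ : ∀ f, φ (N.W f) = vacuumValue f) (f g : TestFn) :
    inner ℂ (N.coherentVector φ f) (N.coherentVector φ g) = weylKernel f g := by
  rw [coherentVector, coherentVector, UniformSpace.Completion.inner_coe,
    PositiveLinearMap.preGNS_inner_def, PositiveLinearMap.ofPreGNS_toPreGNS,
    PositiveLinearMap.ofPreGNS_toPreGNS, star_W_mul_W, map_smul, hφ, smul_eq_mul, weylKernel]

theorem dense_span_coherentVector (φ : A →ₚ[ℂ] ℂ) :
    Dense (Submodule.span ℂ (Set.range (N.coherentVector φ)) : Set φ.GNS) := by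
  let ι : A →ₗ[ℂ] φ.GNS :=
    { toFun := fun a => (φ.toPreGNS a : φ.GNS)
      map_add' := fun a b => by rw [map_add, UniformSpace.Completion.coe_add]
      map_smul' := fun r a => by rw [map_smul, UniformSpace.Completion.coe_smul]; rfl }
  have hι : ∀ a, ι a = φ.gnsStarAlgHom a (φ.toPreGNS 1 : φ.GNS) := fun a => by
    change _ = φ.gnsNonUnitalStarAlgHom a (φ.toPreGNS 1 : φ.GNS)
    rw [PositiveLinearMap.gnsNonUnitalStarAlgHom_apply_coe,
      PositiveLinearMap.leftMulMapPreGNS_apply]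
    simp [ι]
  have hcont : Continuous ι := by
    have h1 : Continuous φ.gnsStarAlgHom := by
      open scoped CStarAlgebra in exact map_continuous φ.gnsStarAlgHom
    have h2 : ⇑ι = fun a => φ.gnsStarAlgHom a (φ.toPreGNS 1 : φ.GNS) := funext hι
    rw [h2]
    exact h1.clm_apply continuous_const
  have hrange : DenseRange ι := by
    have h : Set.range ι = Set.range ((↑) : φ.PreGNS → φ.GNS) := by
      ext ψ
      constructor
      · rintro ⟨a, rfl⟩; exact ⟨φ.toPreGNS a, rfl⟩
      · rintro ⟨a, rfl⟩; exact ⟨φ.ofPreGNS a, rfl⟩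
    rw [DenseRange, h]
    exact UniformSpace.Completion.denseRange_coe
  refine (hrange.dense_image hcont N.dense_span_W).mono ?_
  rw [← Submodule.map_coe, Submodule.map_span, ← Set.range_comp]
  exact le_rfl

end WeylAlgebra

/-- Every Weyl algebra with a vacuum state carries the representation of the Poincaré group which
makes it a massless free field. -/
theorem WeylAlgebra.nonempty_masslessFreeField {A : Type*} [CStarAlgebra A] [PartialOrder A]
    [StarOrderedRing A] (N : WeylAlgebra A) {φ : A →ₚ[ℂ] ℂ}
    (hφ : ∀ f, φ (N.W f) = vacuumValue f) : Nonempty (MasslessFreeField A) := by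
  obtain ⟨U, hU⟩ := exists_unitary_representation (N.dense_span_coherentVector φ)
    TestFn.transform TestFn.transform_one TestFn.transform_mul fun L f g => by
      rw [N.inner_coherentVector hφ, N.inner_coherentVector hφ, weylKernel_transform]
  refine ⟨{ N with
    state := φ
    state_W := hφ
    U := U
    U_implements := fun L f ψ => ?_
    U_vacuum := fun L => ?_ }⟩
  · have : ((U L).toLinearIsometry.toContinuousLinearMap ∘L φ.gnsStarAlgHom (N.W f)) =
        φ.gnsStarAlgHom (N.W (f.transform L)) ∘L
          (U L).toLinearIsometry.toContinuousLinearMap := by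
      refine ContinuousLinearMap.ext_on (N.dense_span_coherentVector φ) ?_
      rintro _ ⟨g, rfl⟩
      change U L (φ.gnsStarAlgHom (N.W f) (N.coherentVector φ g)) =
        φ.gnsStarAlgHom (N.W (f.transform L)) (U L (N.coherentVector φ g))
      rw [hU, N.gnsStarAlgHom_coherentVector, N.gnsStarAlgHom_coherentVector, map_smul, hU,
        TestFn.transform_add, commutatorFn_transform]
    exact congrArg (fun S => S ψ) this
  · have h := hU L 0
    rw [TestFn.transform_zero, N.coherentVector_zero] at h
    exact h

/-! ### Existence -/

theorem eq_of_inner_eq_one {H : Type*} [NormedAddCommGroup H] [InnerProductSpace ℂ H]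
    {x y : H} (hx : inner ℂ x x = 1) (hy : inner ℂ y y = 1) (hxy : inner ℂ x y = 1) : x = y := by
  have hyx : inner ℂ y x = 1 := by rw [← inner_conj_symm, hxy, map_one]
  rw [← sub_eq_zero, ← inner_self_eq_zero (𝕜 := ℂ)]
  rw [inner_sub_left, inner_sub_right, inner_sub_right, hx, hy, hxy, hyx]
  ring

/-- Weyl operators on the Hilbert space which the vacuum functional determines: `W f` maps the
vector `e g` that stands for `W(g) Ω` to the one which the Weyl relations prescribe. -/
theorem exists_weylOperators :
    ∃ (H : Type) (_ : NormedAddCommGroup H) (_ : InnerProductSpace ℂ H) (_ : CompleteSpace H)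
      (Ω : H) (W : TestFn → (H →L[ℂ] H)), W 0 = 1 ∧
      (∀ f k, W (f + dAlembertian k) = W f) ∧
      (∀ f g, W f * W g = Complex.exp (-commutatorFn f g / 2) • W (f + g)) ∧
      (∀ f, star (W f) = W (-f)) ∧ ∀ f, inner ℂ Ω (W f Ω) = vacuumValue f := by
  obtain ⟨H, _, _, _, e, he, hd⟩ := exists_hilbert_of_posSemidef posSemidef_weylKernel
  simp only [Matrix.of_apply] at he
  have hconj : ∀ f g, (starRingEnd ℂ) (Complex.exp (-commutatorFn f g / 2)) =
      Complex.exp (commutatorFn f g / 2) := fun f g => by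
    rw [← Complex.exp_conj, map_div₀, map_neg, conj_commutatorFn, neg_neg, Complex.conj_ofNat]
  have hgram : ∀ f g g', inner ℂ (Complex.exp (-commutatorFn f g / 2) • e (f + g))
      (Complex.exp (-commutatorFn f g' / 2) • e (f + g')) = inner ℂ (e g) (e g') :=
    fun f g g' => by
      rw [inner_smul_left, inner_smul_right, hconj, he, he, weylKernel, weylKernel,
        add_sub_add_left_eq_sub, ← mul_assoc, ← mul_assoc, ← Complex.exp_add, ← Complex.exp_add]
      congr 2
      simp only [commutatorFn_add_left, commutatorFn_add_right, commutatorFn_self,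
        commutatorFn_swap f g]
      ring
  choose T hT using fun f => exists_isometry_of_inner_eq
    (e' := fun g => Complex.exp (-commutatorFn f g / 2) • e (f + g)) hd (hgram f)
  set W : TestFn → (H →L[ℂ] H) := fun f => (T f).toContinuousLinearMap with hW
  have hWe : ∀ f g, W f (e g) = Complex.exp (-commutatorFn f g / 2) • e (f + g) := hT
  have hext : ∀ S S' : H →L[ℂ] H, (∀ g, S (e g) = S' (e g)) → S = S' := fun S S' h => by
    refine ContinuousLinearMap.ext_on hd ?_
    rintro _ ⟨g, rfl⟩
    exact h g
  have hzero : W 0 = 1 := hext _ _ fun g => by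
    rw [hWe, commutatorFn_zero_left, zero_add]; simp
  have hmul : ∀ f g, W f * W g = Complex.exp (-commutatorFn f g / 2) • W (f + g) :=
    fun f g => hext _ _ fun k => by
      rw [mul_apply_eq_comp, smul_apply, hWe, hWe, map_smul, hWe,
        smul_smul, smul_smul, ← Complex.exp_add, ← Complex.exp_add, add_assoc,
        commutatorFn_add_left, commutatorFn_add_right]
      congr 2; ring
  refine ⟨H, inferInstance, inferInstance, inferInstance, e 0, W, hzero, fun f k => ?_, hmul,
    fun f => ?_, fun f => ?_⟩
  · have hk : ∀ g, e (g + dAlembertian k) = e g := fun g => by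
      refine eq_of_inner_eq_one ?_ ?_ ?_
      · rw [he, weylKernel_self]
      · rw [he, weylKernel_self]
      · rw [he, weylKernel, sub_add_cancel_left, vacuumValue_neg, vacuumValue_dAlembertian,
          commutatorFn_add_left, commutatorFn_dAlembertian_left, commutatorFn_self]
        simp
    refine hext _ _ fun g => ?_
    rw [hWe, hWe, commutatorFn_add_left, commutatorFn_dAlembertian_left, add_zero,
      add_right_comm, hk]
  · -- `W f` is isometric with right inverse `W (-f)`
    have h1 : star (W f) * W f = 1 :=
      (ContinuousLinearMap.norm_map_iff_adjoint_comp_self (W f)).mp (T f).norm_map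
    have h2 : W f * W (-f) = 1 := by
      rw [hmul, add_neg_cancel, hzero, commutatorFn_neg_right, commutatorFn_self]; simp
    exact left_inv_eq_right_inv h1 h2
  · rw [hWe, inner_smul_right, add_zero, he, weylKernel_zero_left, commutatorFn_zero_right]
    simp

/-- The closed `*`-algebra generated by the Weyl operators, with the vector state of `Ω`, is a
massless free field. -/
theorem exists_masslessFreeField :
    ∃ (A : Type) (_ : CStarAlgebra A) (_ : PartialOrder A) (_ : StarOrderedRing A),
      Nonempty (MasslessFreeField A) := by
  obtain ⟨H, _, _, _, Ω, W, hzero, hbox, hmul, hstar, hvac⟩ := exists_weylOperators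
  set S : StarSubalgebra ℂ (H →L[ℂ] H) :=
    (StarAlgebra.adjoin ℂ (Set.range W)).topologicalClosure with hS
  have hclosed : IsClosed (S : Set (H →L[ℂ] H)) := StarSubalgebra.isClosed_topologicalClosure _
  have hmem : ∀ f, W f ∈ S := fun f => StarSubalgebra.le_topologicalClosure _
    (StarAlgebra.subset_adjoin ℂ _ ⟨f, rfl⟩)
  let _ : CStarAlgebra S := StarSubalgebra.cstarAlgebra S
  let _ : PartialOrder S := CStarAlgebra.spectralOrder S
  let _ : StarOrderedRing S := CStarAlgebra.spectralOrderedRing S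
  let WS : TestFn → S := fun f => ⟨W f, hmem f⟩
  let N : WeylAlgebra S :=
    { W := WS
      W_zero := Subtype.ext hzero
      W_add_dAlembertian := fun f k => Subtype.ext (hbox f k)
      W_mul := fun f g => Subtype.ext (hmul f g)
      W_star := fun f => Subtype.ext (hstar f)
      generates := by
        have himage : (Subtype.val '' (StarAlgebra.adjoin ℂ (Set.range WS) : Set S)) =
            (StarAlgebra.adjoin ℂ (Set.range W) : Set (H →L[ℂ] H)) := by
          have h := StarAlgHom.map_adjoin S.subtype (Set.range WS)
          rw [← Set.range_comp] at h
          exact congrArg (fun B : StarSubalgebra ℂ (H →L[ℂ] H) => (B : Set (H →L[ℂ] H))) h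
        refine eq_top_iff.mpr fun a _ => ?_
        change a ∈ closure (StarAlgebra.adjoin ℂ (Set.range WS) : Set S)
        have h : (a : H →L[ℂ] H) ∈
            closure (Subtype.val '' (StarAlgebra.adjoin ℂ (Set.range WS) : Set S)) := by
          rw [himage]; exact a.2
        rw [Topology.IsInducing.subtypeVal.closure_eq_preimage_closure_image]
        exact h }
  let φ₀ : S →ₗ[ℂ] ℂ :=
    { toFun := fun a => inner ℂ Ω ((a : H →L[ℂ] H) Ω)
      map_add' := fun a b => by
        change inner ℂ Ω ((a : H →L[ℂ] H) Ω + (b : H →L[ℂ] H) Ω) = _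
        rw [inner_add_right]
      map_smul' := fun r a => by
        change inner ℂ Ω (r • (a : H →L[ℂ] H) Ω) = _
        rw [inner_smul_right]; rfl }
  let φ : S →ₚ[ℂ] ℂ := PositiveLinearMap.mk₀ φ₀ fun a ha => by
    obtain ⟨b, rfl⟩ := CStarAlgebra.nonneg_iff_eq_star_mul_self.mp ha
    change 0 ≤ inner ℂ Ω (ContinuousLinearMap.adjoint (b : H →L[ℂ] H) ((b : H →L[ℂ] H) Ω))
    rw [ContinuousLinearMap.adjoint_inner_right, inner_self_eq_norm_sq_to_K]
    have h := Complex.zero_le_real.mpr (sq_nonneg ‖(b : H →L[ℂ] H) Ω‖)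
    rwa [Complex.ofReal_pow] at h
  exact ⟨S, inferInstance, inferInstance, inferInstance,
    N.nonempty_masslessFreeField (φ := φ) hvac⟩

/-! ### Translated test functions -/

namespace TestFn

/-- The test function translated by `t` in a lightlike direction. -/
noncomputable def shift (lam : Lightlike) (t : ℝ) (f : TestFn) : TestFn :=
  f.transform (Poincare.translation (lam.point t))

theorem exists_radius (f : TestFn) : ∃ R, 0 ≤ R ∧ ∀ x, f x ≠ 0 → ‖x‖ ≤ R := by
  obtain ⟨R, hR⟩ := f.hasCompactSupport.isCompact.isBounded.exists_norm_le
  exact ⟨max R 0, le_max_right _ _, fun x hx =>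
    (hR x (subset_tsupport _ hx)).trans (le_max_left _ _)⟩

/-- Translations are continuous in the `L¹` norm. -/
theorem tendsto_integral_abs_translate_sub (f : TestFn) (b : Spacetime) :
    Tendsto (fun a => ∫ x, |f.transform (Poincare.translation a) x -
      f.transform (Poincare.translation b) x|) (𝓝 b) (𝓝 0) := by
  obtain ⟨R, -, hR⟩ := f.exists_radius
  obtain ⟨M, hM⟩ := f.hasCompactSupport.exists_bound_of_continuous f.continuous
  simp only [transform_translation_apply]
  have h0 : ∫ x, |f (x - b) - f (x - b)| = 0 := by simp
  rw [← h0]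
  refine tendsto_integral_filter_of_dominated_convergence
    ((Metric.closedBall (0 : Spacetime) (R + ‖b‖ + 1)).indicator fun _ => M + M)
    (Eventually.of_forall fun a => ?_) ?_ ?_ (ae_of_all _ fun x => ?_)
  · have := f.continuous
    have : Continuous fun x => |f (x - a) - f (x - b)| := by fun_prop
    exact this.aestronglyMeasurable
  · filter_upwards [Metric.ball_mem_nhds b one_pos] with a ha
    refine ae_of_all _ fun x => ?_
    rw [Real.norm_eq_abs, abs_abs]
    by_cases hx : x ∈ Metric.closedBall (0 : Spacetime) (R + ‖b‖ + 1)
    · rw [Set.indicator_of_mem hx]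
      exact (abs_sub _ _).trans (add_le_add (hM _) (hM _))
    · have hx' : R + ‖b‖ + 1 < ‖x‖ := by simpa using hx
      have hz : ∀ c : Spacetime, ‖c‖ ≤ ‖b‖ + 1 → f (x - c) = 0 := fun c hc => by
        by_contra hne
        have h1 := hR _ hne
        have h2 := norm_sub_norm_le x c
        linarith
      have ha' : ‖a‖ ≤ ‖b‖ + 1 := by
        have h1 : ‖a - b‖ < 1 := by simpa [dist_eq_norm] using ha
        have h2 := norm_sub_norm_le a b
        linarith
      rw [hz a ha', hz b (by linarith), Set.indicator_of_notMem hx]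
      simp
  · exact (integrable_indicator_iff measurableSet_closedBall).mpr
      (integrableOn_const (isCompact_closedBall _ _).measure_lt_top.ne)
  · have := f.continuous
    have : Continuous fun a => |f (x - a) - f (x - b)| := by fun_prop
    exact this.tendsto b

end TestFn

theorem Lightlike.continuous_point (lam : Lightlike) : Continuous lam.point := by
  cases lam
  · change Continuous fun t : ℝ => (t, t)
    fun_prop
  · change Continuous fun t : ℝ => (t, -t)
    fun_prop

theorem Lightlike.norm_point_sub (lam : Lightlike) (s t : ℝ) :
    ‖lam.point s - lam.point t‖ = |s - t| := by
  cases lam <;> simp only [Lightlike.point, Prod.norm_def, Prod.fst_sub, Prod.snd_sub,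
    Real.norm_eq_abs]
  · simp
  · rw [neg_sub_neg, abs_sub_comm t s, max_self]

theorem charge_shift (lam : Lightlike) (t : ℝ) (f : TestFn) : charge (f.shift lam t) = charge f :=
  charge_transform _ f

theorem continuous_commutatorFn_shift (lam : Lightlike) (f k : TestFn) :
    Continuous fun t => commutatorFn (f.shift lam t) k := by
  refine continuous_iff_continuousAt.mpr fun b => ?_
  rw [ContinuousAt, tendsto_iff_norm_sub_tendsto_zero]
  have h := ((f.tendsto_integral_abs_translate_sub (lam.point b)).comp
    (lam.continuous_point.tendsto b)).mul_const (2⁻¹ * ∫ x, |k x|)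
  rw [zero_mul] at h
  refine squeeze_zero (fun t => norm_nonneg _) (fun t => ?_) h
  rw [← commutatorFn_sub_left]
  refine (norm_commutatorFn_le _ _).trans (le_of_eq ?_)
  simp only [Function.comp_apply, TestFn.shift, sub_apply]
  ring

/-- A difference of two translates of `f` has charge zero and vacuum expectation value
`exp(-O(|a - b|))`. -/
theorem exists_vacuumValue_translate_sub (f : TestFn) : ∃ C, ∀ a b : Spacetime, ∃ r,
    0 ≤ r ∧ r ≤ C * ‖a - b‖ ∧ vacuumValue (f.transform (Poincare.translation a) -
      f.transform (Poincare.translation b)) = (Real.exp (-r) : ℂ) := by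
  obtain ⟨C, hC, hf⟩ := exists_norm_amplitude_le f
  refine ⟨(2 * Real.pi)⁻¹ * (2 * C ^ 2 * ∫ p : ℝ, (1 + p ^ 2)⁻¹) / 2, fun a b => ?_⟩
  set F := f.transform (Poincare.translation a) - f.transform (Poincare.translation b) with hF
  have hcharge : charge F = 0 := by
    rw [hF, charge_sub, charge_transform, charge_transform, sub_self]
  refine ⟨(twoPoint 0 F F).re / 2, div_nonneg (twoPoint_self_re_nonneg 0 F) two_pos.le, ?_, ?_⟩
  swap
  · rw [vacuumValue_of_charge_eq_zero hcharge, twoPoint_self_eq_re]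
    push_cast
    congr 1
    rw [Complex.ofReal_re]
    ring
  have hbound : ∀ p : ℝ, (2 * energy 0 p)⁻¹ * ‖amplitude F (energy 0 p, p)‖ ^ 2 ≤
      2 * ‖a - b‖ * C ^ 2 * (1 + p ^ 2)⁻¹ := fun p => by
    rw [energy_zero_left]
    set k : Spacetime := (|p|, p) with hk
    have hA : ‖amplitude f k‖ ^ 2 ≤ C ^ 2 * (1 + p ^ 2)⁻¹ := by
      have h1 := hf k
      have h2 : C / (1 + p ^ 2) ≤ C := div_le_self hC (by nlinarith)
      calc ‖amplitude f k‖ ^ 2 = ‖amplitude f k‖ * ‖amplitude f k‖ := sq _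
        _ ≤ C * (C / (1 + p ^ 2)) := by gcongr; exact h1.trans h2
        _ = _ := by rw [div_eq_mul_inv]; ring
    set u := Complex.exp (-Complex.I * (minkowski k a : ℂ))
    set v := Complex.exp (-Complex.I * (minkowski k b : ℂ))
    have hFk : amplitude F k = (u - v) * amplitude f k := by
      rw [hF, amplitude_sub, amplitude_translate, amplitude_translate, sub_mul]
    have huv1 : ‖u - v‖ ≤ 2 := by
      refine (norm_sub_le _ _).trans ?_
      rw [norm_exp_neg_I_mul, norm_exp_neg_I_mul]; norm_num
    have huv2 : ‖u - v‖ ≤ 2 * |p| * ‖a - b‖ := by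
      have h1 : u - v = v * (Complex.exp (-Complex.I * (minkowski k (a - b) : ℂ)) - 1) := by
        have : minkowski k (a - b) = minkowski k a - minkowski k b := by
          simp [minkowski]; ring
        rw [mul_sub, mul_one, ← Complex.exp_add, this]
        simp only [u]
        congr 2
        push_cast
        ring
      rw [h1, norm_mul, norm_exp_neg_I_mul, one_mul]
      refine (norm_exp_neg_I_mul_sub_one_le _).trans ((abs_minkowski_le _ _).trans (le_of_eq ?_))
      simp only [hk, abs_abs]; ring
    rcases eq_or_ne p 0 with hp | hp
    · simp only [hp, abs_zero, mul_zero, inv_zero, zero_mul]; positivity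
    have hp' : 0 < 2 * |p| := by positivity
    rw [hFk, norm_mul, mul_pow, inv_mul_le_iff₀ hp']
    -- one factor `‖u - v‖` suffices to cancel the singularity of `1 / |p|`
    calc ‖u - v‖ ^ 2 * ‖amplitude f k‖ ^ 2 = ‖u - v‖ * ‖u - v‖ * ‖amplitude f k‖ ^ 2 := by ring
      _ ≤ 2 * (2 * |p| * ‖a - b‖) * (C ^ 2 * (1 + p ^ 2)⁻¹) := by gcongr
      _ = _ := by ring
  rw [twoPoint_self, Complex.ofReal_re]
  have hmono := integral_mono_of_nonneg (ae_of_all _ fun p => by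
    have := energy_nonneg 0 p
    change 0 ≤ (2 * energy 0 p)⁻¹ * ‖amplitude F (energy 0 p, p)‖ ^ 2
    positivity) (integrable_inv_one_add_sq.const_mul (2 * ‖a - b‖ * C ^ 2))
    (ae_of_all _ hbound)
  rw [integral_const_mul] at hmono
  have hpi : 0 ≤ (2 * Real.pi)⁻¹ := by positivity
  have h2 := mul_le_mul_of_nonneg_left hmono hpi
  linarith

/-! ### Asymptotic values of the commutator function -/

theorem commutatorFn_translate (f g : TestFn) (a b : Spacetime) :
    commutatorFn (f.transform (Poincare.translation a)) (g.transform (Poincare.translation b)) =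
      -(Complex.I / 4) * ((∫ z : Spacetime × Spacetime,
        f z.1 * g z.2 * lightconeSign (z.1 - z.2 + (a - b)) : ℝ) : ℂ) := by
  have : (volume : Measure (Spacetime × Spacetime)).IsAddRightInvariant := by
    rw [Measure.volume_eq_prod]; infer_instance
  rw [commutatorFn_eq_lightconeSign, ← integral_sub_right_eq_self (fun z : Spacetime × Spacetime =>
    f z.1 * g z.2 * lightconeSign (z.1 - z.2 + (a - b))) (a, b)]
  congr 3; ext z
  rw [TestFn.transform_translation_apply, TestFn.transform_translation_apply]
  simp only [Prod.fst_sub, Prod.snd_sub]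
  congr 2; abel

theorem commutatorFn_translate_of_eqOn (f g : TestFn) (a b : Spacetime) {c : ℝ}
    (h : ∀ x y, f x ≠ 0 → g y ≠ 0 → lightconeSign (x - y + (a - b)) = c) :
    commutatorFn (f.transform (Poincare.translation a)) (g.transform (Poincare.translation b)) =
      -(Complex.I / 4) * (charge f * charge g * c) := by
  have e : ∀ z : Spacetime × Spacetime,
      f z.1 * g z.2 * lightconeSign (z.1 - z.2 + (a - b)) = f z.1 * g z.2 * c := fun z => by
    by_cases h1 : f z.1 = 0
    · simp [h1]
    by_cases h2 : g z.2 = 0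
    · simp [h2]
    rw [h _ _ h1 h2]
  have hprod : ∫ z : Spacetime × Spacetime, f z.1 * g z.2 = charge f * charge g :=
    integral_prod_mul (fun x => f x) (fun x => g x)
  rw [commutatorFn_translate]
  simp only [e]
  rw [integral_mul_const, hprod]
  push_cast
  rfl

/-- Late left-moving translates of `g` are spacelike to late right-moving translates of `f` and lie
in the future of early right-moving translates of `f`. -/
theorem exists_commutatorFn_shift_eq (f g : TestFn) : ∃ R, ∀ s t, R < t →
    (R < s → commutatorFn (g.shift .minus t) (f.shift .plus s) = 0) ∧
    (s < -R → commutatorFn (g.shift .minus t) (f.shift .plus s) =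
      -(Complex.I / 2) * charge f * charge g) := by
  obtain ⟨R, hR, hf⟩ := f.exists_radius
  obtain ⟨R', hR', hg⟩ := g.exists_radius
  have habs : ∀ x y : Spacetime, g x ≠ 0 → f y ≠ 0 →
      |x.1| ≤ R' ∧ |x.2| ≤ R' ∧ |y.1| ≤ R ∧ |y.2| ≤ R := fun x y hx hy =>
    ⟨(norm_fst_le x).trans (hg x hx), (norm_snd_le x).trans (hg x hx),
      (norm_fst_le y).trans (hf y hy), (norm_snd_le y).trans (hf y hy)⟩
  refine ⟨R + R', fun s t ht => ⟨fun hs => ?_, fun hs => ?_⟩⟩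
  · rw [TestFn.shift, TestFn.shift, commutatorFn_translate_of_eqOn g f _ _ (c := 0)]
    · simp
    · intro x y hx hy
      obtain ⟨h1, h2, h3, h4⟩ := habs x y hx hy
      rw [abs_le] at h1 h2 h3 h4
      simp only [lightconeSign, Lightlike.point, Prod.fst_add, Prod.snd_add, Prod.fst_sub,
        Prod.snd_sub]
      rw [Real.sign_of_pos (by linarith), Real.sign_of_neg (by linarith)]
      norm_num
  · rw [TestFn.shift, TestFn.shift, commutatorFn_translate_of_eqOn g f _ _ (c := 2)]
    · push_cast; ring
    · intro x y hx hy
      obtain ⟨h1, h2, h3, h4⟩ := habs x y hx hy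
      rw [abs_le] at h1 h2 h3 h4
      simp only [lightconeSign, Lightlike.point, Prod.fst_add, Prod.snd_add, Prod.fst_sub,
        Prod.snd_sub]
      rw [Real.sign_of_pos (by linarith), Real.sign_of_pos (by linarith)]
      norm_num

/-- The commutator function of two translates in the same lightlike direction is eventually
constant. -/
theorem exists_commutatorFn_shift_self (lam : Lightlike) (f : TestFn) : ∃ (R : ℝ) (c : ℂ),
    ∀ s s', R < s - s' → commutatorFn (f.shift lam s) (f.shift lam s') = c := by
  obtain ⟨R, hR, hf⟩ := f.exists_radius
  suffices h : ∃ F : Spacetime → ℝ, ∀ s s', 2 * R < s - s' → ∀ x y, f x ≠ 0 → f y ≠ 0 →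
      lightconeSign (x - y + (lam.point s - lam.point s')) = F (x - y) by
    obtain ⟨F, hF⟩ := h
    refine ⟨2 * R, -(Complex.I / 4) * ((∫ z : Spacetime × Spacetime,
        f z.1 * f z.2 * F (z.1 - z.2) : ℝ) : ℂ), fun s s' hs => ?_⟩
    rw [TestFn.shift, TestFn.shift, commutatorFn_translate]
    congr 3; ext z
    by_cases h1 : f z.1 = 0
    · simp [h1]
    by_cases h2 : f z.2 = 0
    · simp [h2]
    rw [hF s s' hs _ _ h1 h2]
  have habs : ∀ x y : Spacetime, f x ≠ 0 → f y ≠ 0 →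
      |x.1| ≤ R ∧ |x.2| ≤ R ∧ |y.1| ≤ R ∧ |y.2| ≤ R := fun x y hx hy =>
    ⟨(norm_fst_le x).trans (hf x hx), (norm_snd_le x).trans (hf x hx),
      (norm_fst_le y).trans (hf y hy), (norm_snd_le y).trans (hf y hy)⟩
  cases lam with
  | plus =>
    refine ⟨fun x => Real.sign (x.1 - x.2) + 1, fun s s' hs x y hx hy => ?_⟩
    obtain ⟨h1, h2, h3, h4⟩ := habs x y hx hy
    rw [abs_le] at h1 h2 h3 h4
    simp only [lightconeSign, Lightlike.point, Prod.fst_add, Prod.snd_add, Prod.fst_sub,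
      Prod.snd_sub]
    rw [add_sub_add_right_eq_sub,
      Real.sign_of_pos (r := x.1 - y.1 + (s - s') + _) (by linarith)]
  | minus =>
    refine ⟨fun x => 1 + Real.sign (x.1 + x.2), fun s s' hs x y hx hy => ?_⟩
    obtain ⟨h1, h2, h3, h4⟩ := habs x y hx hy
    rw [abs_le] at h1 h2 h3 h4
    simp only [lightconeSign, Lightlike.point, Prod.fst_add, Prod.snd_add, Prod.fst_sub,
      Prod.snd_sub]
    have e : x.1 - y.1 + (s - s') + (x.2 - y.2 + (-s - -s')) = x.1 - y.1 + (x.2 - y.2) := by ring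
    rw [e, Real.sign_of_pos (by linarith)]

/-- Differences of right- and left-moving translates have disjoint supports on the light cone in
momentum space. -/
theorem spectral_shift_sub_shift_sub (f g : TestFn) (s s' t t' p : ℝ) :
    spectral (f.shift .plus s' - f.shift .plus s) (g.shift .minus t' - g.shift .minus t)
      (|p|, p) = 0 := by
  simp only [spectral, TestFn.shift, amplitude_sub, amplitude_translate]
  rcases le_total 0 p with hp | hp
  · simp [minkowski, Lightlike.point, abs_of_nonneg hp]
  · simp [minkowski, Lightlike.point, abs_of_nonpos hp]

/-! ### Coherent vectors in the vacuum representation -/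

/-- Independence of neutral fields whose amplitudes have disjoint supports on the light cone. -/
theorem vacuumValue_add_of_spectral_eq_zero {F G : TestFn} (hF : charge F = 0)
    (hG : charge G = 0) (h : ∀ p : ℝ, spectral F G (|p|, p) = 0) :
    vacuumValue (F + G) = vacuumValue F * vacuumValue G := by
  have hFG : charge (F + G) = 0 := by
    have h1 := charge_sub (F + G) G
    rw [add_sub_cancel_right, hF, hG, sub_zero] at h1
    exact h1.symm
  have h0 : twoPoint 0 F G = 0 := by
    rw [twoPoint_eq_shellIntegral, shellIntegral_zero_congr (Φ' := 0) h]
    simp [shellIntegral]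
  have h0' : twoPoint 0 G F = 0 := by rw [twoPoint_swap 0 F G, h0, map_zero]
  have hsum : twoPoint 0 (F + G) (F + G) = twoPoint 0 F F + twoPoint 0 G G := by
    have h1 : twoPoint 0 (F + G) (F + G) = twoPoint 0 F F + twoPoint 0 G F +
        (twoPoint 0 F G + twoPoint 0 G G) := by
      have iFF := infraredRegular_spectral_of_charge_left hF F
      have iFG := infraredRegular_spectral_of_charge_left hF G
      have iGF := infraredRegular_spectral_of_charge_left hG F
      have iGG := infraredRegular_spectral_of_charge_left hG G
      simp only [twoPoint_eq_shellIntegral, spectral_add_left, spectral_add_right]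
      rw [(iFF.add iGF).shellIntegral_add (iFG.add iGG), iFF.shellIntegral_add iGF,
        iFG.shellIntegral_add iGG]
      ring
    rw [h1, h0, h0']; ring
  rw [vacuumValue_of_charge_eq_zero hF, vacuumValue_of_charge_eq_zero hG,
    vacuumValue_of_charge_eq_zero hFG, hsum, ← Complex.exp_add]
  congr 1; ring

theorem commutatorFn_eq_zero_of_spectral_eq_zero {F G : TestFn}
    (h : ∀ p : ℝ, spectral F G (|p|, p) = 0) : commutatorFn F G = 0 := by
  rw [commutatorFn_eq, shellIntegral_zero_congr (Φ' := 0) fun p => by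
    rw [Pi.sub_apply, spectral_swap F G, h p]; simp]
  simp [shellIntegral]

theorem tendsto_weylKernel_shift (lam : Lightlike) (f k : TestFn) (b : ℝ) :
    Tendsto (fun t => weylKernel (f.shift lam t + k) (f.shift lam b + k)) (𝓝 b) (𝓝 1) := by
  obtain ⟨C, hC⟩ := exists_vacuumValue_translate_sub f
  choose r hr0 hr hv using hC
  have h1 : Tendsto (fun t => commutatorFn (f.shift lam t + k) (f.shift lam b + k)) (𝓝 b)
      (𝓝 0) := by
    have hc : Continuous fun t => commutatorFn (f.shift lam t + k) (f.shift lam b + k) := by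
      simp only [commutatorFn_add_left]
      exact (continuous_commutatorFn_shift lam f _).add continuous_const
    have := hc.tendsto b
    rwa [commutatorFn_self] at this
  have h2 : Tendsto (fun t => vacuumValue (f.shift lam b + k - (f.shift lam t + k))) (𝓝 b)
      (𝓝 1) := by
    have hr' : Tendsto (fun t => r (lam.point b) (lam.point t)) (𝓝 b) (𝓝 0) := by
      have hc : Continuous fun t => C * |b - t| := by fun_prop
      have h0 := hc.tendsto b
      rw [sub_self, abs_zero, mul_zero] at h0
      refine squeeze_zero (fun t => hr0 _ _) (fun t => ?_) h0
      rw [← lam.norm_point_sub]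
      exact hr _ _
    have he := (Complex.continuous_ofReal.tendsto _).comp
      ((Real.continuous_exp.tendsto _).comp hr'.neg)
    rw [neg_zero, Real.exp_zero, Complex.ofReal_one] at he
    refine he.congr fun t => ?_
    rw [add_sub_add_right_eq_sub, TestFn.shift, TestFn.shift, hv]
    rfl
  have h3 := ((Complex.continuous_exp.tendsto _).comp (h1.div_const 2)).mul h2
  simpa [weylKernel] using h3

namespace MasslessFreeField

variable {A : Type*} [CStarAlgebra A] [PartialOrder A] [StarOrderedRing A]
  (N : MasslessFreeField A)

/-- The vector `π(W(f)) Ω`. -/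
noncomputable def coherent (f : TestFn) : N.state.GNS :=
  N.toWeylAlgebra.coherentVector N.state f

theorem vacuum_eq : N.vacuum = N.coherent 0 := N.toWeylAlgebra.coherentVector_zero.symm

theorem weylOp_coherent (f g : TestFn) : N.weylOp f (N.coherent g) =
    Complex.exp (-commutatorFn f g / 2) • N.coherent (f + g) :=
  N.toWeylAlgebra.gnsStarAlgHom_coherentVector f g

theorem weylOp_vacuum (f : TestFn) : N.weylOp f N.vacuum = N.coherent f := by
  rw [vacuum_eq, weylOp_coherent, commutatorFn_zero_right, add_zero]; simp

theorem inner_coherent (f g : TestFn) :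
    inner ℂ (N.coherent f) (N.coherent g) = weylKernel f g :=
  N.toWeylAlgebra.inner_coherentVector N.state_W f g

theorem norm_coherent_sub_sq (f g : TestFn) :
    ‖N.coherent f - N.coherent g‖ ^ 2 = 2 - 2 * (weylKernel f g).re := by
  rw [@norm_sub_sq ℂ, inner_coherent]
  have h : ∀ f, ‖N.coherent f‖ ^ 2 = 1 := fun f => by
    have := inner_self_eq_norm_sq_to_K (𝕜 := ℂ) (N.coherent f)
    rw [inner_coherent, weylKernel_self] at this
    exact Complex.ofReal_injective (by rw [Complex.ofReal_pow]; exact this.symm)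
  rw [h, h]
  change 1 - 2 * (weylKernel f g).re + 1 = _
  ring

theorem continuous_coherent_shift (lam : Lightlike) (f k : TestFn) :
    Continuous fun t => N.coherent (f.shift lam t + k) := by
  refine continuous_iff_continuousAt.mpr fun b => ?_
  rw [ContinuousAt, tendsto_iff_norm_sub_tendsto_zero]
  have h1 := ((Complex.continuous_re.tendsto _).comp
    (tendsto_weylKernel_shift lam f k b)).const_mul 2
  have h2 := (h1.const_sub 2).sqrt
  rw [Complex.one_re, mul_one, sub_self, Real.sqrt_zero] at h2
  refine h2.congr fun t => ?_
  rw [Function.comp_apply, ← N.norm_coherent_sub_sq, Real.sqrt_sq (norm_nonneg _)]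

theorem norm_weylOp_apply (f : TestFn) (ψ : N.state.GNS) : ‖N.weylOp f ψ‖ = ‖ψ‖ := by
  refine (ContinuousLinearMap.norm_map_iff_adjoint_comp_self (N.weylOp f)).mpr ?_ ψ
  change star (N.state.gnsStarAlgHom (N.W f)) * N.state.gnsStarAlgHom (N.W f) = 1
  rw [← map_star, ← map_mul, N.toWeylAlgebra.star_W_mul_W, commutatorFn_self, sub_self,
    N.W_zero]
  simp

/-- Strong continuity of lightlike translations of a Weyl operator. -/
theorem continuous_weylOp_shift (lam : Lightlike) (f : TestFn) (ψ : N.state.GNS) :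
    Continuous fun t => N.weylOp (f.shift lam t) ψ := by
  have hspan : ∀ χ ∈ Submodule.span ℂ (Set.range N.coherent),
      Continuous fun t => N.weylOp (f.shift lam t) χ := fun χ hχ => by
    induction hχ using Submodule.span_induction with
    | mem χ h =>
      obtain ⟨k, rfl⟩ := h
      simp only [weylOp_coherent]
      have := continuous_commutatorFn_shift lam f k
      have := N.continuous_coherent_shift lam f k
      fun_prop
    | zero => simpa only [map_zero] using continuous_const
    | add χ χ' _ _ h h' => simp only [map_add]; exact h.add h'
    | smul r χ _ h => simp only [map_smul]; exact h.const_smul r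
  refine continuous_of_uniform_approx_of_continuous fun u hu => ?_
  obtain ⟨ε, hε, hεu⟩ := Metric.mem_uniformity_dist.mp hu
  obtain ⟨χ, hχ, hdist⟩ :=
    (N.toWeylAlgebra.dense_span_coherentVector N.state).exists_dist_lt ψ hε
  refine ⟨_, hspan χ hχ, fun t => hεu ?_⟩
  rwa [dist_eq_norm, ← map_sub, norm_weylOp_apply, ← dist_eq_norm]

/-- The four-point functions of Weyl operators factorize, up to a phase, if the differences
`f' - f` and `g' - g` are neutral and have disjoint supports on the light cone. -/
theorem inner_weylOp_coherent {f f' g g' : TestFn} (hf : charge (f' - f) = 0)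
    (hg : charge (g' - g) = 0) (h : ∀ p : ℝ, spectral (f' - f) (g' - g) (|p|, p) = 0) :
    inner ℂ (N.weylOp f (N.coherent g)) (N.weylOp f' (N.coherent g')) =
      Complex.exp (commutatorFn g f' - commutatorFn g f) *
        (weylKernel f f' * weylKernel g g') := by
  have hconj : (starRingEnd ℂ) (Complex.exp (-commutatorFn f g / 2)) =
      Complex.exp (commutatorFn f g / 2) := by
    rw [← Complex.exp_conj, map_div₀, map_neg, conj_commutatorFn, neg_neg, Complex.conj_ofNat]
  have hD := commutatorFn_eq_zero_of_spectral_eq_zero h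
  simp only [commutatorFn_sub_left, commutatorFn_sub_right] at hD
  have hsum : f' + g' - (f + g) = (f' - f) + (g' - g) := by abel
  rw [weylOp_coherent, weylOp_coherent, inner_smul_left, inner_smul_right, hconj, inner_coherent]
  simp only [weylKernel]
  rw [hsum, vacuumValue_add_of_spectral_eq_zero hf hg h]
  have hexp : Complex.exp (commutatorFn f g / 2) * (Complex.exp (-commutatorFn f' g' / 2) *
      Complex.exp (commutatorFn (f + g) (f' + g') / 2)) =
      Complex.exp (commutatorFn g f' - commutatorFn g f) *
        (Complex.exp (commutatorFn f f' / 2) * Complex.exp (commutatorFn g g' / 2)) := by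
    rw [← Complex.exp_add, ← Complex.exp_add, ← Complex.exp_add, ← Complex.exp_add]
    congr 1
    simp only [commutatorFn_add_left, commutatorFn_add_right]
    rw [commutatorFn_swap f' g, commutatorFn_swap f g]
    linear_combination (-1 / 2) * hD
  linear_combination (vacuumValue (f' - f) * vacuumValue (g' - g)) * hexp

/-- Averages of Weyl operators are averages over translated test functions. -/
theorem averaged_weylOp (h : ℝ → ℝ) (lam : Lightlike) (T : ℝ) (f : TestFn) (ψ : N.state.GNS) :
    averaged N.U h lam T (N.weylOp f) ψ =
      ∫ t : ℝ, (rescaled h T t : ℂ) • N.weylOp (f.shift lam t) ψ := by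
  rw [averaged]
  congr 1; ext t
  congr 1
  set L := Poincare.translation (lam.point t)
  have h1 : N.U L (N.U L⁻¹ ψ) = ψ := by
    have : (N.U L * N.U L⁻¹) ψ = ψ := by rw [← map_mul, mul_inv_cancel, map_one]; rfl
    exact this
  have h2 := N.U_implements L f (N.U L⁻¹ ψ)
  rw [h1] at h2
  exact h2

end MasslessFreeField

/-! ### Averages -/

/-- Continuous compactly supported probability densities on the line. -/
structure IsWeight (c : ℝ → ℝ) : Prop where
  continuous : Continuous c
  hasCompactSupport : HasCompactSupport c
  nonneg : ∀ t, 0 ≤ c t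
  integral_eq_one : ∫ t, c t = 1

namespace IsWeight

variable {c c' : ℝ → ℝ}

theorem integrable_smul {E : Type*} [NormedAddCommGroup E] [NormedSpace ℂ E] (hc : IsWeight c)
    {X : ℝ → E} (hX : Continuous X) : Integrable fun t => (c t : ℂ) • X t := by
  refine ((Complex.continuous_ofReal.comp hc.continuous).smul hX).integrable_of_hasCompactSupport ?_
  exact (hc.hasCompactSupport.comp_left (g := ((↑) : ℝ → ℂ)) Complex.ofReal_zero).smul_right

theorem le_re_integral (hc : IsWeight c) {φ : ℝ → ℂ} (hφ : Continuous φ) {δ : ℝ}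
    (h : ∀ t, c t ≠ 0 → δ ≤ (φ t).re) : δ ≤ (∫ t, (c t : ℂ) * φ t).re := by
  have hint := hc.integrable_smul hφ
  simp only [smul_eq_mul] at hint
  have h1 : (∫ t, (c t : ℂ) * φ t).re = ∫ t, c t * (φ t).re := by
    refine (integral_re hint).symm.trans (integral_congr_ae (ae_of_all _ fun t => ?_))
    exact Complex.re_ofReal_mul _ _
  have h2 : δ = ∫ t, c t * δ := by rw [integral_mul_const, hc.integral_eq_one, one_mul]
  rw [h1, h2]
  refine integral_mono ?_ ?_ fun t => ?_
  · exact (hc.continuous.integrable_of_hasCompactSupport hc.hasCompactSupport).mul_const δ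
  · exact (hc.continuous.mul (Complex.continuous_re.comp hφ)).integrable_of_hasCompactSupport
      hc.hasCompactSupport.mul_right
  · rcases eq_or_ne (c t) 0 with h0 | h0
    · simp [h0]
    · exact mul_le_mul_of_nonneg_left (h t h0) (hc.nonneg t)

theorem inner_integral_integral {H : Type*} [NormedAddCommGroup H] [InnerProductSpace ℂ H]
    [CompleteSpace H] (hc : IsWeight c) (hc' : IsWeight c') {X X' : ℝ → H} (hX : Continuous X)
    (hX' : Continuous X') : inner ℂ (∫ t, (c t : ℂ) • X t) (∫ t, (c' t : ℂ) • X' t) =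
      ∫ t, ∫ t', ((c t : ℂ) * (c' t' : ℂ)) * inner ℂ (X t) (X' t') := by
  have h2 : ∀ x, inner ℂ x (∫ t, (c' t : ℂ) • X' t) = ∫ t', (c' t' : ℂ) * inner ℂ x (X' t') :=
    fun x => by
      rw [← integral_inner (hc'.integrable_smul hX')]
      simp only [inner_smul_right]
  rw [← inner_conj_symm, ← integral_inner (hc.integrable_smul hX), ← integral_conj]
  congr 1; ext t
  rw [inner_conj_symm, inner_smul_left, Complex.conj_ofReal, h2, ← integral_const_mul]
  congr 1; ext t'
  ring

end IsWeight

theorem isWeight_rescaled {h : 𝓓((⊤ : Opens ℝ), ℝ)} (hh : IsAveraging h) {T : ℝ}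
    (hT : 0 < Real.log |T|) : IsWeight (rescaled h T) := by
  have hcont := h.continuous
  refine ⟨?_, ?_, fun t => ?_, ?_⟩
  · unfold rescaled
    fun_prop
  · have h1 : HasCompactSupport fun t => h ((t - T) / Real.log |T|) := by
      let e : ℝ ≃ₜ ℝ := (Homeomorph.subRight T).trans (Homeomorph.mulRight₀ _ (inv_ne_zero hT.ne'))
      exact h.hasCompactSupport.comp_homeomorph e
    exact h1.mul_left
  · exact mul_nonneg (inv_nonneg.mpr hT.le) (hh.nonneg _)
  · simp only [rescaled]
    rw [integral_const_mul, integral_sub_right_eq_self (fun t => h (t / Real.log |T|)) T,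
      Measure.integral_comp_div, hh.integral_eq_one, smul_eq_mul, mul_one, abs_of_pos hT,
      inv_mul_cancel₀ hT.ne']

/-- Since `log T = o(T)`, the averages at time `±T` are taken over times which tend to `±∞`. -/
theorem eventually_rescaled_support (h : 𝓓((⊤ : Opens ℝ), ℝ)) (R : ℝ) : ∀ᶠ T : ℝ in atTop,
    0 < Real.log |T| ∧ (∀ t, rescaled h T t ≠ 0 → R < t) ∧
      ∀ t, rescaled h (-T) t ≠ 0 → t < -R := by
  obtain ⟨B, hB⟩ := h.hasCompactSupport.isCompact.isBounded.exists_norm_le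
  have hB' : ∀ t, h t ≠ 0 → |t| ≤ |B| + 1 := fun t ht =>
    (hB t (subset_tsupport _ ht)).trans ((le_abs_self B).trans (by linarith))
  have hlog := Real.isLittleO_log_id_atTop.bound
    (by positivity : 0 < (2 * (|B| + 1))⁻¹)
  filter_upwards [hlog, eventually_gt_atTop 1, eventually_gt_atTop (2 * R)] with T h1 h2 h3
  have hT0 : 0 < T := by linarith
  have hpos : 0 < Real.log T := Real.log_pos h2
  have hsmall : (|B| + 1) * Real.log T ≤ T / 2 := by
    simp only [id, Real.norm_eq_abs, abs_of_pos hpos, abs_of_pos hT0] at h1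
    have hb : 0 < |B| + 1 := by positivity
    calc (|B| + 1) * Real.log T ≤ (|B| + 1) * ((2 * (|B| + 1))⁻¹ * T) := by gcongr
      _ = T / 2 := by field_simp
  have key : ∀ S t, |S| = T → rescaled h S t ≠ 0 → |t - S| ≤ T / 2 := fun S t hS ht => by
    have hne : h ((t - S) / Real.log |S|) ≠ 0 := right_ne_zero_of_mul ht
    have := hB' _ hne
    rw [hS, abs_div, abs_of_pos hpos, div_le_iff₀ hpos] at this
    exact this.trans hsmall
  refine ⟨by rwa [abs_of_pos hT0], fun t ht => ?_, fun t ht => ?_⟩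
  · have := (abs_le.mp (key T t (abs_of_pos hT0) ht)).1
    linarith
  · have := (abs_le.mp (key (-T) t (by rw [abs_neg, abs_of_pos hT0]) ht)).2
    linarith

/-! ### Scattering amplitudes -/

namespace MasslessFreeField

variable {A : Type*} [CStarAlgebra A] [PartialOrder A] [StarOrderedRing A]
  (N : MasslessFreeField A)

/-- The overlap of the single excitations `F_±(h_T) Ω` and `F_±(h_{-T}) Ω`. -/
noncomputable def overlap (h : ℝ → ℝ) (lam : Lightlike) (f : TestFn) (T : ℝ) : ℂ :=
  inner ℂ (averaged N.U h lam T (N.weylOp f) N.vacuum)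
    (averaged N.U h lam (-T) (N.weylOp f) N.vacuum)

theorem averaged_vacuum (h : ℝ → ℝ) (lam : Lightlike) (T : ℝ) (f : TestFn) :
    averaged N.U h lam T (N.weylOp f) N.vacuum =
      ∫ t : ℝ, (rescaled h T t : ℂ) • N.coherent (f.shift lam t) := by
  rw [averaged_weylOp]
  simp only [weylOp_vacuum]

theorem continuous_coherent_shift_zero (lam : Lightlike) (f : TestFn) :
    Continuous fun t => N.coherent (f.shift lam t) := by
  simpa using N.continuous_coherent_shift lam f 0

theorem overlap_eq {h : ℝ → ℝ} {T : ℝ} (hc : IsWeight (rescaled h T))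
    (hc' : IsWeight (rescaled h (-T))) (lam : Lightlike) (f : TestFn) :
    N.overlap h lam f T = ∫ t, ∫ t', ((rescaled h T t : ℂ) * (rescaled h (-T) t' : ℂ)) *
      weylKernel (f.shift lam t) (f.shift lam t') := by
  rw [overlap, averaged_vacuum, averaged_vacuum, hc.inner_integral_integral hc'
    (N.continuous_coherent_shift_zero lam f) (N.continuous_coherent_shift_zero lam f)]
  simp only [inner_coherent]

/-- At large times the overlap is a fixed phase times an average of positive numbers. -/
theorem eventually_overlap_ne_zero {h : 𝓓((⊤ : Opens ℝ), ℝ)} (hh : IsAveraging h)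
    (lam : Lightlike) (f : TestFn) : ∀ᶠ T in atTop, N.overlap h lam f T ≠ 0 := by
  obtain ⟨R, d, hd⟩ := exists_commutatorFn_shift_self lam f
  obtain ⟨C, hC⟩ := exists_vacuumValue_translate_sub f
  filter_upwards [eventually_rescaled_support h |R|] with T ⟨hlog, hsupp, hsupp'⟩
  have hc := isWeight_rescaled hh hlog
  have hc' : IsWeight (rescaled h (-T)) := isWeight_rescaled hh (by rwa [abs_neg])
  set c := rescaled h T
  set c' := rescaled h (-T)
  have hcoh := N.continuous_coherent_shift_zero lam f
  set X : ℝ → N.state.GNS := fun t => N.coherent (f.shift lam t) with hX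
  -- on the compact supports of the weights the vacuum expectation values are at least `δ`
  obtain ⟨M, hM⟩ := hc.hasCompactSupport.isCompact.isBounded.exists_norm_le
  obtain ⟨M', hM'⟩ := hc'.hasCompactSupport.isCompact.isBounded.exists_norm_le
  set δ := Real.exp (-(|C| * (M + M')))
  set b := Complex.exp (-d / 2)
  have hlow : ∀ t t', c t ≠ 0 → c' t' ≠ 0 → δ ≤ (b * inner ℂ (X t) (X t')).re :=
    fun t t' ht ht' => by
      obtain ⟨r, -, hr, hv⟩ := hC (lam.point t') (lam.point t)
      have hR := le_abs_self R
      have h1 := hsupp t ht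
      have h2 := hsupp' t' ht'
      have hR0 := abs_nonneg R
      rw [hX, inner_coherent, weylKernel, hd t t' (by linarith), TestFn.shift, TestFn.shift, hv,
        ← mul_assoc, ← Complex.exp_add]
      have h0 : -d / 2 + d / 2 = 0 := by ring
      rw [h0, Complex.exp_zero, one_mul, Complex.ofReal_re, Real.exp_le_exp, neg_le_neg_iff]
      have ht1 : |t| ≤ M := hM t (subset_tsupport _ ht)
      have ht2 : |t'| ≤ M' := hM' t' (subset_tsupport _ ht')
      rw [lam.norm_point_sub] at hr
      calc r ≤ C * |t' - t| := hr
        _ ≤ |C| * (M + M') := by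
          gcongr
          · exact le_abs_self C
          · exact (abs_sub _ _).trans (by linarith)
  intro h0
  have hξ : Continuous fun t => b * inner ℂ (X t) (∫ t', (c' t' : ℂ) • X t') :=
    continuous_const.mul (hcoh.inner continuous_const)
  have hδ : δ ≤ (∫ t, (c t : ℂ) * (b * inner ℂ (X t) (∫ t', (c' t' : ℂ) • X t'))).re := by
    refine hc.le_re_integral hξ fun t ht => ?_
    have e : b * inner ℂ (X t) (∫ t', (c' t' : ℂ) • X t') =
        ∫ t', (c' t' : ℂ) * (b * inner ℂ (X t) (X t')) := by
      rw [← integral_inner (hc'.integrable_smul hcoh), ← integral_const_mul]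
      congr 1; ext t'
      rw [inner_smul_right]; ring
    rw [e]
    exact hc'.le_re_integral (continuous_const.mul (continuous_const.inner hcoh))
      fun t' ht' => hlow t t' ht ht'
  have e2 : ∫ t, (c t : ℂ) * (b * inner ℂ (X t) (∫ t', (c' t' : ℂ) • X t')) =
      b * N.overlap h lam f T := by
    rw [N.overlap_eq hc hc', ← integral_const_mul]
    congr 1; ext t
    rw [← integral_inner (hc'.integrable_smul hcoh), ← integral_const_mul, ← integral_const_mul,
      ← integral_const_mul]
    congr 1; ext t'
    rw [inner_smul_right, hX, inner_coherent]
    ring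
  rw [e2, h0, mul_zero, Complex.zero_re] at hδ
  exact absurd hδ (not_le.mpr (Real.exp_pos _))

/-- At large times the scattering vectors overlap like the tensors, up to the phase from commuting
the left-moving field past the right-moving one. -/
theorem eventually_inner_scatteringVector {h : 𝓓((⊤ : Opens ℝ), ℝ)} (hh : IsAveraging h)
    (f g : TestFn) : ∀ᶠ T in atTop,
    inner ℂ (scatteringVector N.U N.vacuum h (N.weylOp f) (N.weylOp g) T)
      (scatteringVector N.U N.vacuum h (N.weylOp f) (N.weylOp g) (-T)) =
      Complex.exp (-(Complex.I / 2) * charge f * charge g) *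
        (N.overlap h .plus f T * N.overlap h .minus g T) := by
  obtain ⟨R, hR⟩ := exists_commutatorFn_shift_eq f g
  filter_upwards [eventually_rescaled_support h R] with T ⟨hlog, hsupp, hsupp'⟩
  have hc := isWeight_rescaled hh hlog
  have hc' : IsWeight (rescaled h (-T)) := isWeight_rescaled hh (by rwa [abs_neg])
  simp only [scatteringVector]
  rw [N.overlap_eq hc hc', N.overlap_eq hc hc', averaged_vacuum, averaged_vacuum, averaged_weylOp,
    averaged_weylOp, hc.inner_integral_integral hc' (N.continuous_weylOp_shift _ f _)
      (N.continuous_weylOp_shift _ f _)]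
  set c := rescaled h T
  set c' := rescaled h (-T)
  set ph := Complex.exp (-(Complex.I / 2) * charge f * charge g)
  have hcoh := N.continuous_coherent_shift_zero .minus g
  have hop : ∀ (c : ℝ → ℝ), IsWeight c → ∀ s,
      N.weylOp (f.shift .plus s) (∫ t, (c t : ℂ) • N.coherent (g.shift .minus t)) =
      ∫ t, (c t : ℂ) • N.weylOp (f.shift .plus s) (N.coherent (g.shift .minus t)) :=
    fun c hc s => by
      rw [← ContinuousLinearMap.integral_comp_comm _ (hc.integrable_smul hcoh)]
      simp only [map_smul]
  have hfour : ∀ s s' t t', (c s : ℂ) * (c' s' : ℂ) * ((c t : ℂ) * (c' t' : ℂ) *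
      inner ℂ (N.weylOp (f.shift .plus s) (N.coherent (g.shift .minus t)))
        (N.weylOp (f.shift .plus s') (N.coherent (g.shift .minus t')))) =
      ph * ((c s : ℂ) * (c' s' : ℂ) * weylKernel (f.shift .plus s) (f.shift .plus s')) *
        ((c t : ℂ) * (c' t' : ℂ) * weylKernel (g.shift .minus t) (g.shift .minus t')) :=
    fun s s' t t' => by
      by_cases hs : c s = 0
      · simp [hs]
      by_cases hs' : c' s' = 0
      · simp [hs']
      by_cases ht : c t = 0
      · simp [ht]
      rw [N.inner_weylOp_coherent (by rw [charge_sub, charge_shift, charge_shift, sub_self])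
        (by rw [charge_sub, charge_shift, charge_shift, sub_self])
        (spectral_shift_sub_shift_sub f g s s' t t'), (hR s' t (hsupp t ht)).2 (hsupp' s' hs'),
        (hR s t (hsupp t ht)).1 (hsupp s hs), sub_zero]
      ring
  have hinner : ∀ s s', (c s : ℂ) * (c' s' : ℂ) * inner ℂ
      (N.weylOp (f.shift .plus s) (∫ t, (c t : ℂ) • N.coherent (g.shift .minus t)))
      (N.weylOp (f.shift .plus s') (∫ t, (c' t : ℂ) • N.coherent (g.shift .minus t))) =
      ph * ((c s : ℂ) * (c' s' : ℂ) * weylKernel (f.shift .plus s) (f.shift .plus s')) *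
        ∫ t, ∫ t', (c t : ℂ) * (c' t' : ℂ) *
          weylKernel (g.shift .minus t) (g.shift .minus t') := fun s s' => by
    rw [hop c hc, hop c' hc', hc.inner_integral_integral hc'
      (X := fun t => N.weylOp (f.shift .plus s) (N.coherent (g.shift .minus t)))
      (X' := fun t => N.weylOp (f.shift .plus s') (N.coherent (g.shift .minus t)))
      ((N.weylOp _).continuous.comp hcoh) ((N.weylOp _).continuous.comp hcoh),
      ← integral_const_mul, ← integral_const_mul]
    congr 1; ext t
    rw [← integral_const_mul, ← integral_const_mul]
    congr 1; ext t'
    exact hfour s s' t t'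
  simp only [hinner, integral_mul_const, integral_const_mul]
  ring

end MasslessFreeField

theorem theorem2p1 :
    (∃ (A : Type) (_ : CStarAlgebra A) (_ : PartialOrder A) (_ : StarOrderedRing A),
      Nonempty (MasslessFreeField A)) ∧
    ∀ (A : Type*) [CStarAlgebra A] [PartialOrder A] [StarOrderedRing A]
      (N : MasslessFreeField A) (h : 𝓓((⊤ : Opens ℝ), ℝ)) (_ : IsAveraging h) (f g : TestFn),
      HasScatteringAmplitude N.U N.vacuum h (N.weylOp f) (N.weylOp g)
        (Complex.exp (-(Complex.I / 2) * (charge f : ℂ) * (charge g : ℂ))) := by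
  refine ⟨exists_masslessFreeField, fun A _ _ _ N h hh f g => ?_⟩
  have htensor : ∀ T, inner ℂ (scatteringTensor N.U N.vacuum h (N.weylOp f) (N.weylOp g) T)
      (scatteringTensor N.U N.vacuum h (N.weylOp f) (N.weylOp g) (-T)) =
      N.overlap h .plus f T * N.overlap h .minus g T := fun T => TensorProduct.inner_tmul _ _ _ _ _
  have hne : ∀ᶠ T in atTop, N.overlap h .plus f T * N.overlap h .minus g T ≠ 0 := by
    filter_upwards [N.eventually_overlap_ne_zero hh .plus f,
      N.eventually_overlap_ne_zero hh .minus g] with T h1 h2 using mul_ne_zero h1 h2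
  refine ⟨?_, ?_, le_of_eq ?_⟩
  · simpa only [htensor] using hne
  · refine tendsto_const_nhds.congr' ?_
    filter_upwards [hne, N.eventually_inner_scatteringVector hh f g] with T h1 h2
    rw [htensor, h2, mul_div_cancel_right₀ _ h1]
  · have e : -(Complex.I / 2) * (charge f : ℂ) * (charge g : ℂ) =
        ((-(charge f * charge g / 2) : ℝ) : ℂ) * Complex.I := by
      push_cast; ring
    rw [e, Complex.norm_exp_ofReal_mul_I]
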